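/- Let $F$ be a totally real number field with ring of integers $\mathcal O_F$ and different $\mathfrak d$, and let $\mathfrak n\subset\mathcal O_F$ be a nonzero ideal. Let $\mathrm{Cl}^+(F)$ be the narrow class group of $F$, and for each $\lambda\in\mathrm{Cl}^+(F)$ fix a fractional ideal $\mathfrak t_\lambda$ of class $\lambda$ that is relatively prime to $\mathfrak n$. Let $\mathrm{GL}_2^+(F)$ be the group of matrices in $\mathrm{GL}_2(F)$ with totally positive determinant, let $B$ be its subgroup of upper triangular matrices, and let $$\Gamma_{1,\lambda}(\mathfrak n)=\left\{\begin{pmatrix}a&b\\c&d\end{pmatrix}\in \mathrm{GL}_2^+(F): a,d\in\mathcal O_F,\ c\in\mathfrak t_\lambda\mathfrak d\mathfrak n,\ b\in(\mathfrak t_\lambda\mathfrak d)^{-1},\ ad-bc\in\mathcal O_F^*,\ d\equiv1\ (\mathrm{mod}\ \mathfrak n)\right\}.$$ The set of cusps of level $\mathfrak n$ is $$\mathrm{cusps}(\mathfrak n)=\bigsqcup_{\lambda\in\mathrm{Cl}^+(F)}\Gamma_{1,\lambda}(\mathfrak n)\backslash \mathrm{GL}_2^+(F)/B .$$ A pair $\mathcal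 A=(A,\lambda)$ with $A=\begin{pmatrix}a&*\\c&*\end{pmatrix}\in\mathrm{GL}_2^+(F)$ and $\lambda\in\mathrm{Cl}^+(F)$ represents a cusp $[\mathcal A]$. Put $$\mathfrak b_{\mathcal A}=a\mathcal O_F+c(\mathfrak t_\lambda\mathfrak d)^{-1},\qquad \mathfrak c_{\mathcal A}=c(\mathfrak t_\lambda\mathfrak d\mathfrak b_{\mathcal A})^{-1},\qquad \mathfrak m_{\mathcal A}=\gcd(\mathfrak c_{\mathcal A},\mathfrak n).$$ For $\mathfrak m\mid\mathfrak n$ let $\mathfrak Q_{\mathfrak m,\mathfrak n}\subset\mathrm{cusps}(\mathfrak n)$ be the set of cusps $[\mathcal A]$ with $\mathfrak m_{\mathcal A}=\mathfrak m$. For a nonzero ideal $\mathfrak a$ of $\mathcal O_F$ let $G^+_{\mathfrak a}$ be the narrow ray class group of modulus $\mathfrak a$, i.e. the fractional ideals relatively prime to $\mathfrak a$ modulo the principal ideals $(x)$ with $x\in F^*$ totally positive and multiplicatively congruent to $1$ modulo $\mathfrak a$. For $\mathfrak m\mid\mathfrak n$ let $Q_{\mathfrak m,\mathfrak n}$ be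 the quotient of $G^+_{\mathfrak m}\times G^+_{\mathfrak n/\mathfrak m}$ by the subgroup generated by the diagonally embedded principal ideals $(x)$, where $x\in\mathcal O_F$ is nonzero and $x\equiv1\ (\mathrm{mod}\ \mathfrak n)$ ($x$ is not required to be totally positive). Then the sets $\mathfrak Q_{\mathfrak m,\mathfrak n}$ for distinct $\mathfrak m\mid\mathfrak n$ are disjoint and $$\mathrm{cusps}(\mathfrak n)=\bigsqcup_{\mathfrak m\mid\mathfrak n}\mathfrak Q_{\mathfrak m,\mathfrak n}.$$ All of the sets $\mathrm{cusps}(\mathfrak n)$, $\mathfrak Q_{\mathfrak m,\mathfrak n}$ and $Q_{\mathfrak m,\mathfrak n}$ are finite. For every $\mathfrak m\mid\mathfrak n$, $$\#\mathfrak Q_{\mathfrak m,\mathfrak n}=\#Q_{\mathfrak m,\mathfrak n},$$ and hence $$\#\mathrm{cusps}(\mathfrak n)=\sum_{\mathfrak m\mid\mathfrak n}\#Q_{\mathfrak m,\mathfrak n}.$$ -/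

import Mathlib

open scoped NumberField nonZeroDivisors

noncomputable section

namespace HilbertCusps

variable (F : Type*) [Field F] [NumberField F]

/-- The group of (invertible, that is nonzero) fractional ideals of `F`. -/
abbrev IdealGroup : Type _ := (FractionalIdeal (𝓞 F)⁰ F)ˣ

/-- The subgroup of totally positive elements of `Fˣ`: those that are positive under every
embedding of `F` into the real numbers. -/
def totPos : Subgroup Fˣ where
  carrier := {x | ∀ φ : F →+* ℝ, 0 < φ (x : F)}
  mul_mem' {x y} hx hy φ := by
    simpa using mul_pos (hx φ) (hy φ)
  one_mem' φ := by simp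
  inv_mem' {x} hx φ := by
    simpa using hx φ

/-- The narrow class group `Cl⁺(F)`: fractional ideals modulo the principal ideals `(x)` with
`x` totally positive. -/
abbrev NarrowClassGroup : Type _ :=
  IdealGroup F ⧸ (totPos F).map (toPrincipalIdeal (𝓞 F) F)

variable {F}

/-- The group of fractional ideals that are relatively prime to `𝔪`: no prime dividing `𝔪` occurs
in their factorization. -/
def coprimeIdeals (𝔪 : Ideal (𝓞 F)) : Subgroup (IdealGroup F) where
  carrier := {I | ∀ v : IsDedekindDomain.HeightOneSpectrum (𝓞 F), v.asIdeal ∣ 𝔪 →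
    FractionalIdeal.count F v (I : FractionalIdeal (𝓞 F)⁰ F) = 0}
  mul_mem' {I J} hI hJ v hv := by
    rw [Units.val_mul, FractionalIdeal.count_mul F v I.ne_zero J.ne_zero, hI v hv, hJ v hv,
      add_zero]
  one_mem' v _ := by
    simpa using FractionalIdeal.count_one F v
  inv_mem' {I} hI v hv := by
    rw [Units.val_inv_eq_inv_val, FractionalIdeal.count_inv, hI v hv, neg_zero]

/-- The elements `x` of `Fˣ` with `x ≡ 1 mod* 𝔪` (multiplicative congruence): quotients `x = α / β`
of integers `α`, `β` that are prime to `𝔪` and congruent to each other modulo `𝔪`. -/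
def congrOne (𝔪 : Ideal (𝓞 F)) : Subgroup Fˣ where
  carrier := {x | ∃ α β : 𝓞 F, IsCoprime (Ideal.span {α}) 𝔪 ∧ IsCoprime (Ideal.span {β}) 𝔪 ∧
    β ≠ 0 ∧ α - β ∈ 𝔪 ∧ (x : F) * algebraMap (𝓞 F) F β = algebraMap (𝓞 F) F α}
  mul_mem' := by
    rintro x y ⟨α, β, hα, hβ, h0, h, e⟩ ⟨α', β', hα', hβ', h0', h', e'⟩
    refine ⟨α * α', β * β', ?_, ?_, mul_ne_zero h0 h0', ?_, ?_⟩
    · rw [← Ideal.span_singleton_mul_span_singleton]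
      exact hα.mul_left hα'
    · rw [← Ideal.span_singleton_mul_span_singleton]
      exact hβ.mul_left hβ'
    · have : α * α' - β * β' = α' * (α - β) + β * (α' - β') := by ring
      rw [this]
      exact 𝔪.add_mem (𝔪.mul_mem_left _ h) (𝔪.mul_mem_left _ h')
    · rw [map_mul, map_mul, ← e, ← e', Units.val_mul]
      ring
  one_mem' := ⟨1, 1, by simp [isCoprime_one_left, ← Ideal.one_eq_top],
    by simp [isCoprime_one_left, ← Ideal.one_eq_top], one_ne_zero, by simp, by simp⟩
  inv_mem' := by
    rintro x ⟨α, β, hα, hβ, h0, h, e⟩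
    refine ⟨β, α, hβ, hα, ?_, ?_, ?_⟩
    · rintro rfl
      have : (x : F) * algebraMap (𝓞 F) F β = 0 := by rw [e, map_zero]
      rcases mul_eq_zero.1 this with h1 | h1
      · exact x.ne_zero h1
      · exact h0 ((FaithfulSMul.algebraMap_eq_zero_iff (𝓞 F) F).1 h1)
    · rw [← neg_sub]
      exact 𝔪.neg_mem h
    · rw [← e]
      simp

/-- The narrow ray class group `G⁺_𝔪` of modulus `𝔪`: fractional ideals relatively prime to `𝔪`
modulo the principal ideals `(x)` with `x` totally positive and `x ≡ 1 mod* 𝔪`. -/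
abbrev NarrowRayClassGroup (𝔪 : Ideal (𝓞 F)) : Type _ :=
  coprimeIdeals 𝔪 ⧸
    ((totPos F ⊓ congrOne 𝔪).map (toPrincipalIdeal (𝓞 F) F)).subgroupOf (coprimeIdeals 𝔪)

/-- The quotient `𝔫 / 𝔪` of integral ideals, used for `𝔪 ∣ 𝔫`. -/
def idealDiv (𝔫 𝔪 : Ideal (𝓞 F)) : Ideal (𝓞 F) where
  carrier := {x | ∀ y ∈ 𝔪, x * y ∈ 𝔫}
  add_mem' {a b} ha hb y hy := by
    rw [add_mul]
    exact 𝔫.add_mem (ha y hy) (hb y hy)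
  zero_mem' y _ := by simp
  smul_mem' c x hx y hy := by
    rw [smul_eq_mul, mul_assoc]
    exact 𝔫.mul_mem_left c (hx y hy)

theorem mul_idealDiv {𝔫 𝔪 : Ideal (𝓞 F)} (hn : 𝔫 ≠ ⊥) (h : 𝔪 ∣ 𝔫) : 𝔪 * idealDiv 𝔫 𝔪 = 𝔫 := by
  obtain ⟨𝔨, rfl⟩ := h
  have hm : 𝔪 ≠ 0 := by
    rintro rfl
    exact hn (zero_mul 𝔨)
  congr 1
  ext x
  have h1 : x ∈ idealDiv (𝔪 * 𝔨) 𝔪 ↔ 𝔪 * Ideal.span {x} ≤ 𝔪 * 𝔨 := by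
    rw [mul_comm 𝔪 (Ideal.span {x}), Ideal.span_singleton_mul_le_iff]
    exact Iff.rfl
  rw [h1, ← Ideal.dvd_iff_le, mul_dvd_mul_iff_left hm, Ideal.dvd_iff_le,
    Ideal.span_singleton_le_iff_mem]

/-- The subgroup of `G⁺_𝔪 × G⁺_{𝔫/𝔪}` generated by the diagonally embedded principal ideals `(x)`
with `x` a nonzero integer of `F` congruent to `1` modulo `𝔫` (of any signature). -/
def diagonalSubgroup (𝔪 𝔫 : Ideal (𝓞 F)) :
    Subgroup (NarrowRayClassGroup 𝔪 × NarrowRayClassGroup (idealDiv 𝔫 𝔪)) :=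
  Subgroup.closure {g | ∃ (x : Fˣ) (x₀ : 𝓞 F) (I : coprimeIdeals 𝔪)
    (J : coprimeIdeals (idealDiv 𝔫 𝔪)), algebraMap (𝓞 F) F x₀ = x ∧ x₀ - 1 ∈ 𝔫 ∧
      (I : IdealGroup F) = toPrincipalIdeal (𝓞 F) F x ∧
      (J : IdealGroup F) = toPrincipalIdeal (𝓞 F) F x ∧
      g = (QuotientGroup.mk I, QuotientGroup.mk J)}

/-- The group `Q_{𝔪,𝔫}`. -/
abbrev Q (𝔪 𝔫 : Ideal (𝓞 F)) : Type _ :=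
  (NarrowRayClassGroup 𝔪 × NarrowRayClassGroup (idealDiv 𝔫 𝔪)) ⧸ diagonalSubgroup 𝔪 𝔫

variable (F) in
/-- `GL₂⁺(F)`: invertible matrices with totally positive determinant. -/
def GL2Plus : Subgroup (GL (Fin 2) F) :=
  (totPos F).comap Matrix.GeneralLinearGroup.det

/-- The fractional ideal `𝔱𝔡`, with `𝔡` the different of `F`. -/
def tdIdeal (𝔱 : IdealGroup F) : FractionalIdeal (𝓞 F)⁰ F :=
  𝔱 * (differentIdeal ℤ (𝓞 F) : FractionalIdeal (𝓞 F)⁰ F)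

theorem tdIdeal_ne_zero (𝔱 : IdealGroup F) : tdIdeal 𝔱 ≠ 0 := by
  refine mul_ne_zero 𝔱.ne_zero ?_
  rw [Ne, FractionalIdeal.coeIdeal_eq_zero]
  exact differentIdeal_ne_bot

theorem inv_entries {K : Type*} [Field K] (A : GL (Fin 2) K) :
    (A⁻¹ 0 0 = (A.det⁻¹ : Kˣ) * A 1 1 ∧ A⁻¹ 0 1 = (A.det⁻¹ : Kˣ) * -A 0 1) ∧
    (A⁻¹ 1 0 = (A.det⁻¹ : Kˣ) * -A 1 0 ∧ A⁻¹ 1 1 = (A.det⁻¹ : Kˣ) * A 0 0) := by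
  have h : ((A⁻¹ : GL (Fin 2) K) : Matrix (Fin 2) (Fin 2) K) =
      ((A.det⁻¹ : Kˣ) : K) • (A : Matrix (Fin 2) (Fin 2) K).adjugate := by
    rw [Matrix.coe_units_inv, Matrix.inv_def, Ring.inverse_eq_inv']
    simp
  rw [h, Matrix.adjugate_fin_two]
  simp

theorem int_mul_mem {I : FractionalIdeal (𝓞 F)⁰ F} {x y : F}
    (hx : x ∈ (1 : FractionalIdeal (𝓞 F)⁰ F)) (hy : y ∈ I) : x * y ∈ I := by
  have := FractionalIdeal.mul_mem_mul hx hy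
  rwa [one_mul] at this

theorem upper_mul_lower {𝔱 : IdealGroup F} {𝔫 : Ideal (𝓞 F)} {x y : F}
    (hx : x ∈ (tdIdeal 𝔱)⁻¹) (hy : y ∈ tdIdeal 𝔱 * (𝔫 : FractionalIdeal (𝓞 F)⁰ F)) :
    x * y ∈ (𝔫 : FractionalIdeal (𝓞 F)⁰ F) := by
  have := FractionalIdeal.mul_mem_mul hx hy
  rwa [inv_mul_cancel_left₀ (tdIdeal_ne_zero 𝔱)] at this

/-- The congruence subgroup `Γ_{1,λ}(𝔫)` of `GL₂⁺(F)`, where `𝔱 = 𝔱_λ`: matrices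
`(a b; c d)` with `a, d ∈ 𝓞`, `c ∈ 𝔱𝔡𝔫`, `b ∈ (𝔱𝔡)⁻¹`, determinant a (totally positive) unit of `𝓞`,
and `d ≡ 1 mod 𝔫`. -/
def Gamma1 (𝔱 : IdealGroup F) (𝔫 : Ideal (𝓞 F)) : Subgroup (GL2Plus F) where
  carrier := {A | A.1 0 0 ∈ (1 : FractionalIdeal (𝓞 F)⁰ F) ∧
    A.1 1 1 ∈ (1 : FractionalIdeal (𝓞 F)⁰ F) ∧
    A.1 1 0 ∈ tdIdeal 𝔱 * (𝔫 : FractionalIdeal (𝓞 F)⁰ F) ∧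
    A.1 0 1 ∈ (tdIdeal 𝔱)⁻¹ ∧
    (∃ u : (𝓞 F)ˣ, (A.1.det : F) = algebraMap (𝓞 F) F u) ∧
    A.1 1 1 - 1 ∈ (𝔫 : FractionalIdeal (𝓞 F)⁰ F)}
  mul_mem' {A B} := by
    rintro ⟨ha, hd, hc, hb, ⟨u, hu⟩, h1⟩ ⟨ha', hd', hc', hb', ⟨u', hu'⟩, h1'⟩
    have hbc := upper_mul_lower hb hc'
    have hcb := upper_mul_lower hb' hc
    rw [mul_comm] at hcb
    have e : ∀ i j, (A * B).1 i j = A.1 i 0 * B.1 0 j + A.1 i 1 * B.1 1 j := fun i j => by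
      change (A.1 * B.1) i j = _
      simp [Matrix.mul_apply, Fin.sum_univ_two]
    refine ⟨?_, ?_, ?_, ?_, ⟨u * u', ?_⟩, ?_⟩
    · rw [e]
      exact Submodule.add_mem _ (int_mul_mem ha ha') (FractionalIdeal.coeIdeal_le_one hbc)
    · rw [e]
      exact Submodule.add_mem _ (FractionalIdeal.coeIdeal_le_one hcb) (int_mul_mem hd hd')
    · rw [e, mul_comm (A.1 1 0)]
      exact Submodule.add_mem _ (int_mul_mem ha' hc) (int_mul_mem hd hc')
    · rw [e, mul_comm (A.1 0 1)]
      exact Submodule.add_mem _ (int_mul_mem ha hb') (int_mul_mem hd' hb)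
    · change ((A.1 * B.1).det : F) = _
      rw [map_mul, Units.val_mul, hu, hu', Units.val_mul, map_mul]
    · rw [e]
      have : A.1 1 0 * B.1 0 1 + A.1 1 1 * B.1 1 1 - 1 =
        A.1 1 0 * B.1 0 1 + (A.1 1 1 * (B.1 1 1 - 1) + (A.1 1 1 - 1)) := by ring
      rw [this]
      exact Submodule.add_mem _ hcb (Submodule.add_mem _ (int_mul_mem hd h1') h1)
  one_mem' := by
    have e : ((1 : GL2Plus F) : GL (Fin 2) F) = 1 := rfl
    refine ⟨?_, ?_, ?_, ?_, ⟨1, ?_⟩, ?_⟩ <;> rw [e]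
    · simp
    · simp
    · rw [Units.val_one, Matrix.one_apply_ne (by decide)]
      exact Submodule.zero_mem _
    · rw [Units.val_one, Matrix.one_apply_ne (by decide)]
      exact Submodule.zero_mem _
    · simp
    · simp
  inv_mem' {A} := by
    rintro ⟨ha, hd, hc, hb, ⟨u, hu⟩, h1⟩
    have hv : ((A.1.det⁻¹ : Fˣ) : F) = algebraMap (𝓞 F) F ((u⁻¹ : (𝓞 F)ˣ) : 𝓞 F) := by
      rw [Units.val_inv_eq_inv_val, hu]
      refine inv_eq_of_mul_eq_one_right ?_
      rw [← map_mul, Units.mul_inv, map_one]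
    have hv1 : ((A.1.det⁻¹ : Fˣ) : F) ∈ (1 : FractionalIdeal (𝓞 F)⁰ F) := by
      rw [hv]
      exact FractionalIdeal.coe_mem_one _ _
    have hdet : (A.1.det : F) = A.1 0 0 * A.1 1 1 - A.1 0 1 * A.1 1 0 := by
      rw [Matrix.GeneralLinearGroup.val_det_apply, Matrix.det_fin_two]
    have e : ((A⁻¹ : GL2Plus F) : GL (Fin 2) F) = A.1⁻¹ := rfl
    have hi := inv_entries A.1
    refine ⟨?_, ?_, ?_, ?_, ⟨u⁻¹, ?_⟩, ?_⟩ <;> rw [e]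
    · rw [hi.1.1]
      exact int_mul_mem hv1 hd
    · rw [hi.2.2]
      exact int_mul_mem hv1 ha
    · rw [hi.2.1]
      exact int_mul_mem hv1 (Submodule.neg_mem _ hc)
    · rw [hi.1.2]
      exact int_mul_mem hv1 (Submodule.neg_mem _ hb)
    · rw [map_inv, hv]
    · have : ((A.1.det⁻¹ : Fˣ) : F) * A.1 0 0 - 1 =
          ((A.1.det⁻¹ : Fˣ) : F) * (A.1 0 1 * A.1 1 0 - A.1 0 0 * (A.1 1 1 - 1)) := by
        have h2 : ((A.1.det⁻¹ : Fˣ) : F) * (A.1.det : F) = 1 := Units.inv_mul _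
        rw [hdet] at h2
        linear_combination h2
      rw [hi.2.2, this]
      exact int_mul_mem hv1 (Submodule.sub_mem _ (upper_mul_lower hb hc) (int_mul_mem ha h1))

variable (F) in
/-- The Borel subgroup of upper triangular matrices in `GL₂⁺(F)`. -/
def borel : Subgroup (GL2Plus F) where
  carrier := {A | A.1 1 0 = 0}
  mul_mem' {A B} hA hB := by
    have hA' : A.1 1 0 = 0 := hA
    have hB' : B.1 1 0 = 0 := hB
    change (A.1 * B.1) 1 0 = 0
    simp [Matrix.mul_apply, Fin.sum_univ_two, hA', hB']
  one_mem' := by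
    change (1 : GL (Fin 2) F) 1 0 = 0
    simp
  inv_mem' {A} hA := by
    have hA' : A.1 1 0 = 0 := hA
    change (A.1⁻¹ : GL (Fin 2) F) 1 0 = 0
    rw [(inv_entries A.1).2.1, hA', neg_zero, mul_zero]

/-- The set of cusps of level `𝔫`: the disjoint union over `λ ∈ Cl⁺(F)` of the double coset spaces
`Γ_{1,λ}(𝔫) \ GL₂⁺(F) / B`. -/
abbrev Cusps (𝔱 : NarrowClassGroup F → IdealGroup F) (𝔫 : Ideal (𝓞 F)) : Type _ :=
  Σ l : NarrowClassGroup F,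
    DoubleCoset.Quotient (Gamma1 (𝔱 l) 𝔫 : Set (GL2Plus F)) (borel F : Set (GL2Plus F))

/-- The cusp `[(A, λ)]`. -/
def cusp (𝔱 : NarrowClassGroup F → IdealGroup F) (𝔫 : Ideal (𝓞 F)) (A : GL2Plus F)
    (l : NarrowClassGroup F) : Cusps 𝔱 𝔫 :=
  ⟨l, DoubleCoset.mk (Gamma1 (𝔱 l) 𝔫) (borel F) A⟩

/-- `𝔟_𝒜 = a𝓞 + c(𝔱𝔡)⁻¹`, where `(a, c)` is the first column of `A`. -/
def bIdeal (𝔱 : IdealGroup F) (A : GL2Plus F) : FractionalIdeal (𝓞 F)⁰ F :=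
  FractionalIdeal.spanSingleton (𝓞 F)⁰ (A.1 0 0) +
    FractionalIdeal.spanSingleton (𝓞 F)⁰ (A.1 1 0) * (tdIdeal 𝔱)⁻¹

/-- `𝔠_𝒜 = c(𝔱𝔡𝔟_𝒜)⁻¹`, where `(a, c)` is the first column of `A`. -/
def cIdeal (𝔱 : IdealGroup F) (A : GL2Plus F) : FractionalIdeal (𝓞 F)⁰ F :=
  FractionalIdeal.spanSingleton (𝓞 F)⁰ (A.1 1 0) * (tdIdeal 𝔱 * bIdeal 𝔱 A)⁻¹

/-- `𝔪_𝒜 = gcd(𝔠_𝒜, 𝔫)`; the greatest common divisor of two ideals is their sum. -/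
def mIdeal (𝔱 : IdealGroup F) (𝔫 : Ideal (𝓞 F)) (A : GL2Plus F) : FractionalIdeal (𝓞 F)⁰ F :=
  cIdeal 𝔱 A + (𝔫 : FractionalIdeal (𝓞 F)⁰ F)

/-- The set of cusps `[𝒜]` with `𝔪_𝒜 = 𝔪`. -/
def stratum (𝔱 : NarrowClassGroup F → IdealGroup F) (𝔪 𝔫 : Ideal (𝓞 F)) : Set (Cusps 𝔱 𝔫) :=
  {x | ∃ (A : GL2Plus F) (l : NarrowClassGroup F), x = cusp 𝔱 𝔫 A l ∧
    mIdeal (𝔱 l) 𝔫 A = (𝔪 : FractionalIdeal (𝓞 F)⁰ F)}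

theorem finite_divisors {𝔫 : Ideal (𝓞 F)} (hn : 𝔫 ≠ ⊥) : {𝔪 : Ideal (𝓞 F) | 𝔪 ∣ 𝔫}.Finite := by
  have := UniqueFactorizationMonoid.fintypeSubtypeDvd 𝔫 hn
  exact Set.finite_coe_iff.1 (Finite.of_fintype {x // x ∣ 𝔫})

end HilbertCusps

end

/-!
A class in `GL₂⁺(F)/B` is a point of `ℙ¹(F)`, that is a column `(a, c) ≠ 0` up to `Fˣ`, so a cusp is
an orbit of `Γ_{1,λ}(𝔫)` on such points. Write `T = 𝔱_λ𝔡` and `𝔟 = a𝓞 + cT⁻¹`. The action of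
`γ ∈ Γ_{1,λ}(𝔫)` on a column fixes `𝔟`, fixes `c` modulo `T𝔟𝔫`, and multiplies `a` modulo `𝔟𝔪` by
the totally positive unit `det γ` (`Gamma1_columnIdeal`, `Gamma1_lower_sub_mem`,
`Gamma1_upper_sub_mem`); in particular `𝔪` is an invariant of the cusp. These data determine the
orbit of the column (`exists_Gamma1_of_congr`). The point is `exists_matrix_of_congr`: the columns
are completed to matrices of determinant `1`, and the freedom in doing so is exactly enough to meet
the congruences that define `Γ_{1,λ}(𝔫)`.

Since `a` generates `𝔟` modulo `𝔟𝔪` and `c` generates `T𝔟𝔪` modulo `T𝔟𝔫`, the column gives rise to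
the fractional ideals `I = α𝔟⁻¹`, prime to `𝔪`, and `J = χ(T𝔟𝔪)⁻¹`, prime to `𝔫/𝔪`, where `α` and
`χ` are lifts to `Fˣ` of these residues with equal signatures (`IsAttached`). Different lifts
change `(I, J)` by principal ideals that are trivial in `G⁺_𝔪 × G⁺_{𝔫/𝔪}` up to a common signature,
which is what the diagonal subgroup of `Q_{𝔪,𝔫}` absorbs (`IsAttached.mk_eq_mk`). Conversely the
class of `(I, J)` recovers first `λ`, as the narrow class of `I(J𝔡𝔪)⁻¹`, then `𝔟` and the residues up
to a scalar and a totally positive unit, hence the cusp (`cusp_eq_of_mk_eq_mk`). Every class occurs,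
because it has representatives with `J` integral and prime to `𝔫/𝔪` and `I` integral and prime to
`𝔪J`, and these come from a column `(1, s)` (`exists_isAttached_of_class`).

Finiteness of `Q_{𝔪,𝔫}` follows from that of the class group, of `𝓞/𝔪` and of the set of signatures
(`finite_narrowRayClassGroup`).
-/

namespace HilbertCusps

open FractionalIdeal

set_option linter.unusedSectionVars false

/-! ### Columns and lattices over a Dedekind domain -/

section Dedekind

variable {R K : Type*} [CommRing R] [IsDedekindDomain R] [Field K] [Algebra R K]
  [IsFractionRing R K]

theorem mul_mem_of_eq {I J L : FractionalIdeal R⁰ K} {x y : K} (hx : x ∈ I) (hy : y ∈ J)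
    (h : I * J = L) : x * y ∈ L :=
  h ▸ mul_mem_mul hx hy

theorem fracIdeal_le_of_mul_le {I J L : FractionalIdeal R⁰ K} (hL : L ≠ 0)
    (h : L * I ≤ L * J) : I ≤ J := by
  have := mul_le_mul_right h L⁻¹
  rwa [inv_mul_cancel_left₀ hL, inv_mul_cancel_left₀ hL] at this

theorem fracIdeal_mul_le_self {I J : FractionalIdeal R⁰ K} (hJ : J ≤ 1) : I * J ≤ I := by
  simpa using mul_le_mul_right hJ I

theorem add_eq_of_sub_mem {J : FractionalIdeal R⁰ K} {x y : K} (h : y - x ∈ J) :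
    spanSingleton R⁰ y + J = spanSingleton R⁰ x + J := by
  have key : ∀ {x y : K}, y - x ∈ J → spanSingleton R⁰ y + J ≤ spanSingleton R⁰ x + J := by
    intro x y h
    refine sup_le ?_ le_sup_right
    rw [spanSingleton_le_iff_mem]
    exact (mem_add _ _ _).2 ⟨x, mem_spanSingleton_self _ _, y - x, h, by ring⟩
  exact le_antisymm (key h) (key (by rw [← neg_sub]; exact Submodule.neg_mem _ h))

/-- The ideal `aR + cT⁻¹` attached to a column vector `(a, c)`; it is the smallest `𝔟` for which
`(a, c)` lies in the lattice `𝔟 ⊕ T𝔟`. -/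
noncomputable def columnIdeal (T : FractionalIdeal R⁰ K) (a c : K) : FractionalIdeal R⁰ K :=
  spanSingleton R⁰ a + spanSingleton R⁰ c * T⁻¹

theorem columnIdeal_le_iff {T b : FractionalIdeal R⁰ K} (hT : T ≠ 0) {a c : K} :
    columnIdeal T a c ≤ b ↔ a ∈ b ∧ c ∈ T * b := by
  have h : spanSingleton R⁰ c * T⁻¹ ≤ b ↔ spanSingleton R⁰ c ≤ T * b := by
    constructor
    · intro h
      have := mul_le_mul_right h T
      rwa [mul_left_comm, mul_inv_cancel₀ hT, mul_one] at this
    · intro h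
      refine fracIdeal_le_of_mul_le hT ?_
      rwa [mul_left_comm, mul_inv_cancel₀ hT, mul_one]
  rw [columnIdeal, ← spanSingleton_le_iff_mem, ← spanSingleton_le_iff_mem, ← h]
  exact sup_le_iff

theorem columnIdeal_ne_zero {T : FractionalIdeal R⁰ K} (hT : T ≠ 0) {a c : K}
    (h : a ≠ 0 ∨ c ≠ 0) : columnIdeal T a c ≠ 0 := by
  intro h0
  have := (columnIdeal_le_iff (b := 0) hT).1 h0.le
  rw [mul_zero, mem_zero_iff, mem_zero_iff] at this
  tauto

theorem columnIdeal_smul (T : FractionalIdeal R⁰ K) (r a c : K) :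
    columnIdeal T (r * a) (r * c) = spanSingleton R⁰ r * columnIdeal T a c := by
  simp only [columnIdeal, ← spanSingleton_mul_spanSingleton]
  ring

/-- The ideal `c(T𝔟)⁻¹ + 𝔫`, with `𝔟 = columnIdeal T a c`. -/
noncomputable def levelIdeal (T n : FractionalIdeal R⁰ K) (a c : K) : FractionalIdeal R⁰ K :=
  spanSingleton R⁰ c * (T * columnIdeal T a c)⁻¹ + n

theorem levelIdeal_le_one {T n : FractionalIdeal R⁰ K} (hT : T ≠ 0) (hn : n ≤ 1) {a c : K}
    (h : a ≠ 0 ∨ c ≠ 0) : levelIdeal T n a c ≤ 1 := by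
  have hb := columnIdeal_ne_zero hT h
  refine sup_le ?_ hn
  have h1 := ((columnIdeal_le_iff hT).1 (le_refl (columnIdeal T a c))).2
  rw [← spanSingleton_le_iff_mem] at h1
  have h2 := mul_le_mul_left h1 (T * columnIdeal T a c)⁻¹
  rwa [mul_inv_cancel₀ (mul_ne_zero hT hb)] at h2

theorem levelIdeal_smul (T n : FractionalIdeal R⁰ K) {r : K} (hr : r ≠ 0) (a c : K) :
    levelIdeal T n (r * a) (r * c) = levelIdeal T n a c := by
  have hr' : spanSingleton R⁰ r ≠ 0 := spanSingleton_ne_zero_iff.2 hr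
  rw [levelIdeal, levelIdeal, columnIdeal_smul, ← spanSingleton_mul_spanSingleton]
  congr 1
  rw [mul_left_comm T, mul_inv, ← mul_assoc, mul_right_comm _ _ (spanSingleton R⁰ r)⁻¹,
    mul_inv_cancel₀ hr', one_mul]

theorem span_add_of_levelIdeal {T n : FractionalIdeal R⁰ K} (hT : T ≠ 0) {a c : K}
    (h : a ≠ 0 ∨ c ≠ 0) :
    spanSingleton R⁰ c + T * columnIdeal T a c * n =
      T * columnIdeal T a c * levelIdeal T n a c := by
  have hb := columnIdeal_ne_zero hT h
  rw [levelIdeal, mul_add, mul_left_comm, mul_inv_cancel₀ (mul_ne_zero hT hb), mul_one]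

theorem span_add_mul_levelIdeal {T n : FractionalIdeal R⁰ K} (hT : T ≠ 0) (hn : n ≤ 1) {a c : K}
    (h : a ≠ 0 ∨ c ≠ 0) :
    spanSingleton R⁰ a + columnIdeal T a c * levelIdeal T n a c = columnIdeal T a c := by
  have hb := columnIdeal_ne_zero hT h
  apply le_antisymm
  · refine sup_le le_sup_left (fracIdeal_mul_le_self (levelIdeal_le_one hT hn h))
  · refine sup_le le_sup_left (le_trans ?_ le_sup_right)
    refine fracIdeal_le_of_mul_le hT ?_
    rw [mul_left_comm, mul_inv_cancel₀ hT, mul_one, ← mul_assoc, ← span_add_of_levelIdeal hT h]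
    exact le_sup_left

/-- Two column vectors with the same ideal `𝔟`, whose lower entries agree modulo `T𝔟𝔫` and whose
upper entries agree modulo `𝔟𝔪`, are related by a matrix `(p q; r s)` of determinant `1` with
`r ∈ T𝔫`, `q ∈ T⁻¹` and `s ≡ 1 mod 𝔫`. Completing the columns to matrices `M`, `M'` of
determinant `1`, the matrix is `M' (1 β; 0 1) M⁻¹` for a suitable `β ∈ 𝔟⁻²T⁻¹`. -/
theorem exists_matrix_of_congr {T b m n : FractionalIdeal R⁰ K} (hT : T ≠ 0) (hb : b ≠ 0)
    {a c a' c' : K} (h : columnIdeal T a c = b) (h' : columnIdeal T a' c' = b)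
    (hm : spanSingleton R⁰ c * (T * b)⁻¹ + n = m) (hc : c' - c ∈ T * b * n)
    (ha : a' - a ∈ b * m) :
    ∃ p q r s : K, p ∈ (1 : FractionalIdeal R⁰ K) ∧ s ∈ (1 : FractionalIdeal R⁰ K) ∧
      r ∈ T * n ∧ q ∈ T⁻¹ ∧ p * s - q * r = 1 ∧ s - 1 ∈ n ∧ p * a + q * c = a' ∧
      r * a + s * c = c' := by
  have hTb : T * b ≠ 0 := mul_ne_zero hT hb
  -- Bezout coefficients of a column with ideal `b`
  have bezout : ∀ {a c : K}, columnIdeal T a c = b →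
      ∃ x ∈ b⁻¹, ∃ y ∈ (T * b)⁻¹, a * x + c * y = 1 := by
    intro a c h
    have h1 : (1 : K) ∈ b * b⁻¹ := by
      rw [mul_inv_cancel₀ hb]
      exact one_mem_one _
    nth_rewrite 1 [← h] at h1
    rw [columnIdeal, add_mul, mul_assoc, ← mul_inv, mem_add] at h1
    obtain ⟨i, hi, j, hj, hij⟩ := h1
    obtain ⟨x, hx, rfl⟩ := mem_singleton_mul.1 hi
    obtain ⟨y, hy, rfl⟩ := mem_singleton_mul.1 hj
    exact ⟨x, hx, y, hy, hij⟩
  obtain ⟨x, hx, y, hy, e⟩ := bezout h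
  obtain ⟨x', hx', y', hy', e'⟩ := bezout h'
  obtain ⟨hab, hcb⟩ := (columnIdeal_le_iff hT).1 h.le
  obtain ⟨hab', hcb'⟩ := (columnIdeal_le_iff hT).1 h'.le
  have hcm : c ∈ T * b * m := by
    rw [← hm, mul_add, mul_left_comm, mul_inv_cancel₀ hTb, mul_one]
    exact (le_sup_left : _ ≤ spanSingleton R⁰ c + T * b * n) (mem_spanSingleton_self _ _)
  have hnm : n ≤ m := hm ▸ le_sup_right
  have hcm' : c' ∈ T * b * m := by
    have : c' = c + (c' - c) := by ring
    rw [this]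
    exact Submodule.add_mem _ hcm (mul_le_mul_right hnm _ hc)
  -- the difference of the two coefficients lies in `b⁻¹ m`
  have hxx : x - x' ∈ b⁻¹ * m := by
    have h1 : a * (x - x') ∈ m := by
      have : a * (x - x') = c' * y' - c * y + (a' - a) * x' := by linear_combination e - e'
      rw [this]
      refine Submodule.add_mem _ (Submodule.sub_mem _ ?_ ?_) ?_
      · exact mul_mem_of_eq hcm' hy' (by field_simp)
      · exact mul_mem_of_eq hcm hy (by field_simp)
      · exact mul_mem_of_eq ha hx' (by field_simp)
    have h2 : c * (x - x') ∈ T * m :=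
      mul_mem_of_eq hcm (Submodule.sub_mem _ hx hx') (by field_simp)
    have h3 : spanSingleton R⁰ (x - x') * columnIdeal T a c ≤ m := by
      rw [← columnIdeal_smul, columnIdeal_le_iff hT]
      exact ⟨by rwa [mul_comm (x - x')], by rwa [mul_comm (x - x')]⟩
    rw [h] at h3
    rw [← spanSingleton_le_iff_mem]
    refine fracIdeal_le_of_mul_le hb ?_
    rwa [mul_inv_cancel_left₀ hb, mul_comm]
  obtain ⟨β, hβ, hz⟩ : ∃ β ∈ b⁻¹ * b⁻¹ * T⁻¹, x - x' - β * c ∈ b⁻¹ * n := by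
    rw [← hm, mul_add, mem_add] at hxx
    obtain ⟨i, hi, j, hj, hij⟩ := hxx
    rw [mul_left_comm] at hi
    obtain ⟨β, hβ, rfl⟩ := mem_singleton_mul.1 hi
    refine ⟨β, ?_, ?_⟩
    · convert! hβ using 1
      field_simp
    · convert! hj using 1
      linear_combination -hij
  have hβ1 : β * c' ∈ b⁻¹ := mul_mem_of_eq hβ hcb' (by field_simp)
  have hβ2 : β * a' ∈ (T * b)⁻¹ := mul_mem_of_eq hβ hab' (by field_simp)
  obtain ⟨x'', hx'', hxe⟩ : ∃ x'' ∈ b⁻¹, x'' = x' + β * c' := ⟨_, Submodule.add_mem _ hx' hβ1, rfl⟩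
  obtain ⟨y'', hy'', hye⟩ : ∃ y'' ∈ (T * b)⁻¹, y'' = y' - β * a' :=
    ⟨_, Submodule.sub_mem _ hy' hβ2, rfl⟩
  have e'' : a' * x'' + c' * y'' = 1 := by
    rw [hxe, hye]
    linear_combination e'
  have hzz : x - x'' ∈ b⁻¹ * n := by
    have : x - x'' = x - x' - β * c - β * (c' - c) := by rw [hxe]; ring
    rw [this]
    exact Submodule.sub_mem _ hz (mul_mem_of_eq hβ hc (by field_simp))
  refine ⟨a' * x + y'' * c, a' * y - y'' * a, c' * x - x'' * c, c' * y + x'' * a,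
    ?_, ?_, ?_, ?_, ?_, ?_, ?_, ?_⟩
  · exact Submodule.add_mem _ (mul_mem_of_eq hab' hx (by field_simp))
      (mul_mem_of_eq hy'' hcb (by field_simp))
  · exact Submodule.add_mem _ (mul_mem_of_eq hcb' hy (by field_simp))
      (mul_mem_of_eq hx'' hab (by field_simp))
  · have : c' * x - x'' * c = (c' - c) * x + c * (x - x'') := by ring
    rw [this]
    exact Submodule.add_mem _ (mul_mem_of_eq hc hx (by field_simp))
      (mul_mem_of_eq hcb hzz (by field_simp))
  · exact Submodule.sub_mem _ (mul_mem_of_eq hab' hy (by field_simp))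
      (mul_mem_of_eq hy'' hab (by field_simp))
  · linear_combination (a' * x'' + c' * y'') * e + e''
  · have : c' * y + x'' * a - 1 = (c' - c) * y - a * (x - x'') := by linear_combination e
    rw [this]
    exact Submodule.sub_mem _ (mul_mem_of_eq hc hy (by field_simp))
      (mul_mem_of_eq hab hzz (by field_simp))
  · linear_combination a' * e
  · linear_combination c' * e

/-- The ideal of a column does not grow under a matrix with entries in the order attached to `T`. -/
theorem columnIdeal_matrix_le {T : FractionalIdeal R⁰ K} (hT : T ≠ 0) {p q r s a c : K}
    (hp : p ∈ (1 : FractionalIdeal R⁰ K)) (hq : q ∈ T⁻¹) (hr : r ∈ T)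
    (hs : s ∈ (1 : FractionalIdeal R⁰ K)) :
    columnIdeal T (p * a + q * c) (r * a + s * c) ≤ columnIdeal T a c := by
  obtain ⟨ha, hc⟩ := (columnIdeal_le_iff hT).1 (le_refl (columnIdeal T a c))
  rw [columnIdeal_le_iff hT]
  exact ⟨Submodule.add_mem _ (mul_mem_of_eq hp ha (by field_simp))
      (mul_mem_of_eq hq hc (by field_simp)),
    Submodule.add_mem _ (mul_mem_of_eq hr ha rfl) (mul_mem_of_eq hs hc (by field_simp))⟩

end Dedekind

/-! ### Ideals prime to `𝔪` and multiplicative congruences -/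

section Congruences

variable {F : Type*} [Field F] [NumberField F]

theorem coeIdeal_add_eq_one_iff {I J : Ideal (𝓞 F)} :
    (I : FractionalIdeal (𝓞 F)⁰ F) + J = 1 ↔ IsCoprime I J := by
  rw [← FractionalIdeal.coeIdeal_sup, ← coeIdeal_top, coeIdeal_inj, Ideal.isCoprime_iff_sup_eq]

theorem add_eq_one_of_mul {I J L : FractionalIdeal (𝓞 F)⁰ F} (hI : I + L = 1) (hJ : J + L = 1) :
    I * J + L = 1 := by
  have hI1 : I ≤ 1 := hI ▸ le_sup_left
  have hJ1 : J ≤ 1 := hJ ▸ le_sup_left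
  have hL1 : L ≤ 1 := hJ ▸ le_sup_right
  apply le_antisymm
  · exact sup_le ((fracIdeal_mul_le_self hJ1).trans hI1) hL1
  · have h : (I + L) * (J + L) ≤ I * J + L := by
      have e : (I + L) * (J + L) = I * J + (L * I + (L * J + L * L)) := by ring
      rw [e]
      refine sup_le le_sup_left (le_trans ?_ le_sup_right)
      exact sup_le (fracIdeal_mul_le_self hI1)
        (sup_le (fracIdeal_mul_le_self hJ1) (fracIdeal_mul_le_self hL1))
    rwa [hI, hJ, one_mul] at h

theorem add_mul_eq_self_iff {I J L : FractionalIdeal (𝓞 F)⁰ F} (hJ : J ≠ 0) :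
    I + J * L = J ↔ I * J⁻¹ + L = 1 := by
  rw [← mul_left_inj' (inv_ne_zero hJ), add_mul, mul_right_comm J, mul_inv_cancel₀ hJ, one_mul]

/-- An integral ideal has valuation zero exactly at the primes not dividing it. -/
theorem count_coeIdeal_eq_zero_iff {I : Ideal (𝓞 F)} (hI : I ≠ ⊥)
    (v : IsDedekindDomain.HeightOneSpectrum (𝓞 F)) :
    FractionalIdeal.count F v (I : FractionalIdeal (𝓞 F)⁰ F) = 0 ↔ ¬ v.asIdeal ∣ I := by
  classical
  rw [FractionalIdeal.count_coe F v hI, Nat.cast_eq_zero, ← not_iff_not, not_not]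
  exact Associates.count_ne_zero_iff_dvd hI v.irreducible

theorem isCoprime_iff_forall_heightOneSpectrum {I J : Ideal (𝓞 F)} (hI : I ≠ ⊥) :
    IsCoprime I J ↔
      ∀ v : IsDedekindDomain.HeightOneSpectrum (𝓞 F), v.asIdeal ∣ J → ¬ v.asIdeal ∣ I := by
  rw [Ideal.isCoprime_iff_sup_eq]
  constructor
  · intro h v hJ hI'
    rw [Ideal.dvd_iff_le] at hJ hI'
    exact v.isPrime.ne_top (top_le_iff.1 (h ▸ sup_le hI' hJ))
  · intro h
    by_contra hne
    obtain ⟨p, hp, hle⟩ := Ideal.exists_le_maximal _ hne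
    have hp0 : p ≠ ⊥ := fun h0 => hI (le_bot_iff.1 (h0 ▸ le_sup_left.trans hle))
    exact h ⟨p, hp.isPrime, hp0⟩ (Ideal.dvd_iff_le.2 (le_sup_right.trans hle))
      (Ideal.dvd_iff_le.2 (le_sup_left.trans hle))

theorem mem_coprimeIdeals_iff_of_eq_coe {𝔪 N : Ideal (𝓞 F)} {I : IdealGroup F}
    (h : (I : FractionalIdeal (𝓞 F)⁰ F) = N) : I ∈ coprimeIdeals 𝔪 ↔ IsCoprime N 𝔪 := by
  have hN : N ≠ ⊥ := by
    rintro rfl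
    exact I.ne_zero (by simp at h)
  rw [isCoprime_iff_forall_heightOneSpectrum hN]
  refine forall₂_congr fun v _ => ?_
  rw [h, count_coeIdeal_eq_zero_iff hN]

theorem mem_coprimeIdeals_of_add_eq_one {𝔪 : Ideal (𝓞 F)} {I : IdealGroup F}
    (h : (I : FractionalIdeal (𝓞 F)⁰ F) + 𝔪 = 1) : I ∈ coprimeIdeals 𝔪 := by
  obtain ⟨N, hN⟩ := le_one_iff_exists_coeIdeal.1 (h ▸ le_sup_left :
    (I : FractionalIdeal (𝓞 F)⁰ F) ≤ 1)
  rw [mem_coprimeIdeals_iff_of_eq_coe hN.symm, ← coeIdeal_add_eq_one_iff, hN, h]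

/-- A fractional ideal prime to `𝔪` is a quotient of integral ideals prime to `𝔪`: the numerator
`I(1 + I)⁻¹` and the denominator `(1 + I)⁻¹` generate the unit ideal, so no prime can divide both. -/
theorem exists_num_den_coprime {𝔪 : Ideal (𝓞 F)} {I : IdealGroup F} (hI : I ∈ coprimeIdeals 𝔪) :
    ∃ N D : Ideal (𝓞 F), IsCoprime N 𝔪 ∧ IsCoprime D 𝔪 ∧ D ≠ ⊥ ∧
      (I : FractionalIdeal (𝓞 F)⁰ F) * D = N := by
  have hI0 : (I : FractionalIdeal (𝓞 F)⁰ F) ≠ 0 := I.ne_zero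
  have hs : 1 + (I : FractionalIdeal (𝓞 F)⁰ F) ≠ 0 := by
    intro h
    exact one_ne_zero (FractionalIdeal.le_zero_iff.1 (h ▸ le_sup_left : (1 : FractionalIdeal (𝓞 F)⁰ F) ≤ 0))
  have hle1 : (1 + (I : FractionalIdeal (𝓞 F)⁰ F))⁻¹ ≤ 1 := by
    refine fracIdeal_le_of_mul_le hs ?_
    rw [mul_inv_cancel₀ hs, mul_one]
    exact le_sup_left
  have hle2 : (I : FractionalIdeal (𝓞 F)⁰ F) * (1 + (I : FractionalIdeal (𝓞 F)⁰ F))⁻¹ ≤ 1 := by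
    refine fracIdeal_le_of_mul_le hs ?_
    rw [mul_left_comm, mul_inv_cancel₀ hs, mul_one, mul_one]
    exact le_sup_right
  obtain ⟨D, hD⟩ := le_one_iff_exists_coeIdeal.1 hle1
  obtain ⟨N, hN⟩ := le_one_iff_exists_coeIdeal.1 hle2
  have hD0 : D ≠ ⊥ := by
    rintro rfl
    rw [coeIdeal_bot] at hD
    exact inv_ne_zero hs hD.symm
  have hN0 : N ≠ ⊥ := by
    rintro rfl
    rw [coeIdeal_bot] at hN
    exact mul_ne_zero hI0 (inv_ne_zero hs) hN.symm
  have hND : IsCoprime D N := by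
    rw [← coeIdeal_add_eq_one_iff, hD, hN]
    nth_rewrite 1 [← one_mul (1 + (I : FractionalIdeal (𝓞 F)⁰ F))⁻¹]
    rw [← add_mul, mul_inv_cancel₀ hs]
  have heq : (I : FractionalIdeal (𝓞 F)⁰ F) * D = N := by rw [hD, hN]
  have hcount : ∀ v : IsDedekindDomain.HeightOneSpectrum (𝓞 F), v.asIdeal ∣ 𝔪 →
      (v.asIdeal ∣ D ↔ v.asIdeal ∣ N) := by
    intro v hv
    rw [← not_iff_not, ← count_coeIdeal_eq_zero_iff hD0, ← count_coeIdeal_eq_zero_iff hN0,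
      ← heq, FractionalIdeal.count_mul F v hI0 (coeIdeal_ne_zero.2 hD0), hI v hv, zero_add]
  have hno : ∀ v : IsDedekindDomain.HeightOneSpectrum (𝓞 F), v.asIdeal ∣ N → ¬ v.asIdeal ∣ D :=
    (isCoprime_iff_forall_heightOneSpectrum hD0).1 hND
  refine ⟨N, D, ?_, ?_, hD0, heq⟩
  · rw [isCoprime_iff_forall_heightOneSpectrum hN0]
    exact fun v hv h => hno v h ((hcount v hv).2 h)
  · rw [isCoprime_iff_forall_heightOneSpectrum hD0]
    exact fun v hv h => hno v ((hcount v hv).1 h) h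

theorem exists_ne_zero_mem_sub_one_mem {I 𝔪 : Ideal (𝓞 F)} (hI : I ≠ ⊥) (h : IsCoprime I 𝔪) :
    ∃ β ∈ I, β ≠ 0 ∧ β - 1 ∈ 𝔪 := by
  obtain ⟨β, hβ, μ, hμ, e⟩ := Ideal.isCoprime_iff_exists.1 h
  have hβμ : β - 1 ∈ 𝔪 := by
    rw [← e, sub_add_cancel_left]
    exact 𝔪.neg_mem hμ
  by_cases h0 : β = 0
  · have htop : 𝔪 = ⊤ := by
      rw [Ideal.eq_top_iff_one]
      simpa [h0] using 𝔪.neg_mem hβμ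
    obtain ⟨γ, hγ, hγ0⟩ := Submodule.exists_mem_ne_zero_of_ne_bot hI
    exact ⟨γ, hγ, hγ0, htop ▸ Submodule.mem_top⟩
  · exact ⟨β, hβ, h0, hβμ⟩

theorem isCoprime_span_of_sub_one_mem {𝔪 : Ideal (𝓞 F)} {β : 𝓞 F} (h : β - 1 ∈ 𝔪) :
    IsCoprime (Ideal.span {β}) 𝔪 := by
  refine Ideal.isCoprime_iff_exists.2 ⟨β, Ideal.mem_span_singleton_self β, 1 - β, ?_, by ring⟩
  rw [← neg_sub]
  exact 𝔪.neg_mem h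

theorem isCoprime_span_of_sub_mem {𝔪 : Ideal (𝓞 F)} {α β : 𝓞 F}
    (hβ : IsCoprime (Ideal.span {β}) 𝔪) (h : α - β ∈ 𝔪) : IsCoprime (Ideal.span {α}) 𝔪 := by
  obtain ⟨γ, hγ, μ, hμ, e⟩ := Ideal.isCoprime_iff_exists.1 hβ
  obtain ⟨r, rfl⟩ := Ideal.mem_span_singleton'.1 hγ
  refine Ideal.isCoprime_iff_exists.2 ⟨r * α, Ideal.mul_mem_left _ _
    (Ideal.mem_span_singleton_self α), μ - r * (α - β),
    𝔪.sub_mem hμ (𝔪.mul_mem_left _ h), by linear_combination e⟩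

/-- An element of `Fˣ` that generates an ideal prime to `𝔪` is a quotient of two integers prime
to `𝔪`. -/
theorem exists_num_den_of_principal_mem {𝔪 : Ideal (𝓞 F)} {x : Fˣ}
    (hx : toPrincipalIdeal (𝓞 F) F x ∈ coprimeIdeals 𝔪) :
    ∃ α β : 𝓞 F, IsCoprime (Ideal.span {α}) 𝔪 ∧ IsCoprime (Ideal.span {β}) 𝔪 ∧ β ≠ 0 ∧
      (x : F) * algebraMap (𝓞 F) F β = algebraMap (𝓞 F) F α := by
  obtain ⟨N, D, hN, hD, hD0, e⟩ := exists_num_den_coprime hx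
  rw [coe_toPrincipalIdeal] at e
  obtain ⟨β, hβD, hβ0, hβ⟩ := exists_ne_zero_mem_sub_one_mem hD0 hD
  have hβc := isCoprime_span_of_sub_one_mem hβ
  have hmem : (x : F) * algebraMap (𝓞 F) F β ∈ (N : FractionalIdeal (𝓞 F)⁰ F) :=
    mul_mem_of_eq (mem_spanSingleton_self _ _) (mem_coeIdeal_of_mem _ hβD) e
  obtain ⟨α, -, hα⟩ := (mem_coeIdeal _).1 hmem
  refine ⟨α, β, ?_, hβc, hβ0, hα.symm⟩
  obtain ⟨E, hE⟩ : D ∣ Ideal.span {β} := by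
    rwa [Ideal.dvd_iff_le, Ideal.span_singleton_le_iff_mem]
  have hNE : Ideal.span {α} = N * E := by
    rw [← coeIdeal_inj (K := F), coeIdeal_mul, coeIdeal_span_singleton, hα,
      ← spanSingleton_mul_spanSingleton, ← coeIdeal_span_singleton, hE, coeIdeal_mul, ← e]
    ring
  rw [hNE]
  exact hN.mul_left (hβc.of_isCoprime_of_dvd_left (hE ▸ dvd_mul_left E D))

theorem congrOne_mono {𝔪 𝔫 : Ideal (𝓞 F)} (h : 𝔪 ∣ 𝔫) : congrOne 𝔫 ≤ congrOne 𝔪 := by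
  rintro x ⟨α, β, hα, hβ, h0, hs, e⟩
  exact ⟨α, β, hα.of_isCoprime_of_dvd_right h, hβ.of_isCoprime_of_dvd_right h, h0,
    Ideal.dvd_iff_le.1 h hs, e⟩

theorem principal_mem_coprimeIdeals_of_num_den {𝔪 : Ideal (𝓞 F)} {x : Fˣ} {α β : 𝓞 F}
    (hα : IsCoprime (Ideal.span {α}) 𝔪) (hβ : IsCoprime (Ideal.span {β}) 𝔪) (h0 : β ≠ 0)
    (e : (x : F) * algebraMap (𝓞 F) F β = algebraMap (𝓞 F) F α) :
    toPrincipalIdeal (𝓞 F) F x ∈ coprimeIdeals 𝔪 := by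
  have hβF : algebraMap (𝓞 F) F β ≠ 0 := by
    rwa [Ne, FaithfulSMul.algebraMap_eq_zero_iff]
  have hαF : algebraMap (𝓞 F) F α ≠ 0 := e ▸ mul_ne_zero x.ne_zero hβF
  have hx : x = Units.mk0 _ hαF * (Units.mk0 _ hβF)⁻¹ := by
    rw [eq_mul_inv_iff_mul_eq]
    ext
    simpa using e
  rw [hx, map_mul, map_inv]
  refine (coprimeIdeals 𝔪).mul_mem ?_ ((coprimeIdeals 𝔪).inv_mem ?_)
  · refine (mem_coprimeIdeals_iff_of_eq_coe (N := Ideal.span {α}) ?_).2 hα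
    rw [coe_toPrincipalIdeal, Units.val_mk0, coeIdeal_span_singleton]
  · refine (mem_coprimeIdeals_iff_of_eq_coe (N := Ideal.span {β}) ?_).2 hβ
    rw [coe_toPrincipalIdeal, Units.val_mk0, coeIdeal_span_singleton]

theorem principal_mem_coprimeIdeals {𝔪 : Ideal (𝓞 F)} {x : Fˣ} (hx : x ∈ congrOne 𝔪) :
    toPrincipalIdeal (𝓞 F) F x ∈ coprimeIdeals 𝔪 := by
  obtain ⟨α, β, hα, hβ, h0, -, e⟩ := hx
  exact principal_mem_coprimeIdeals_of_num_den hα hβ h0 e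

/-- A multiplicative congruence gives an additive one: multiplication by `z ≡ 1 mod* 𝔨` changes an
element of `J` by an element of `J𝔨`, provided that the product still lies in `J`. -/
theorem mul_sub_mem_of_mem_congrOne {𝔨 : Ideal (𝓞 F)} {z : Fˣ} (hz : z ∈ congrOne 𝔨)
    {J : FractionalIdeal (𝓞 F)⁰ F} {y : F} (hy : y ∈ J) (hzy : (z : F) * y ∈ J) :
    (z : F) * y - y ∈ J * (𝔨 : FractionalIdeal (𝓞 F)⁰ F) := by
  obtain ⟨α, β, -, hβ, -, h, e⟩ := hz
  obtain ⟨γ, hγ, μ, hμ, e1⟩ := Ideal.isCoprime_iff_exists.1 hβ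
  obtain ⟨r, rfl⟩ := Ideal.mem_span_singleton'.1 hγ
  have e2 : algebraMap (𝓞 F) F r * algebraMap (𝓞 F) F β + algebraMap (𝓞 F) F μ = 1 := by
    rw [← map_mul, ← map_add, e1, map_one]
  have key : (z : F) * y - y =
      y * algebraMap (𝓞 F) F (r * (α - β)) + (z * y - y) * algebraMap (𝓞 F) F μ := by
    rw [map_mul, map_sub]
    linear_combination (y - z * y) * e2 + y * algebraMap (𝓞 F) F r * e
  rw [key]
  refine Submodule.add_mem _ (mul_mem_mul hy (mem_coeIdeal_of_mem _ (𝔨.mul_mem_left _ h)))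
    (mul_mem_mul (Submodule.sub_mem _ hzy hy) (mem_coeIdeal_of_mem _ hμ))

/-- An additive congruence gives a multiplicative one: if `y` generates `J` modulo `J𝔨` and
`y' ≡ y mod J𝔨`, then `y' / y ≡ 1 mod* 𝔨`. -/
theorem div_mem_congrOne {𝔨 : Ideal (𝓞 F)} {J : FractionalIdeal (𝓞 F)⁰ F} (hJ : J ≠ 0)
    {y y' : Fˣ} (hy : spanSingleton (𝓞 F)⁰ (y : F) + J * (𝔨 : FractionalIdeal (𝓞 F)⁰ F) = J)
    (h : (y' : F) - y ∈ J * (𝔨 : FractionalIdeal (𝓞 F)⁰ F)) : y' / y ∈ congrOne 𝔨 := by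
  have hyJ : spanSingleton (𝓞 F)⁰ (y : F) ≤ J := hy.le.trans' le_sup_left
  have hle : spanSingleton (𝓞 F)⁰ (y : F) * J⁻¹ ≤ 1 := by
    have := mul_le_mul_left hyJ J⁻¹
    rwa [mul_inv_cancel₀ hJ] at this
  obtain ⟨N, hN⟩ := le_one_iff_exists_coeIdeal.1 hle
  have hN0 : N ≠ ⊥ := by
    rintro rfl
    rw [coeIdeal_bot] at hN
    exact mul_ne_zero (spanSingleton_ne_zero_iff.2 y.ne_zero) (inv_ne_zero hJ) hN.symm
  have hNk : IsCoprime N 𝔨 := by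
    rwa [← coeIdeal_add_eq_one_iff, hN, ← add_mul_eq_self_iff hJ]
  obtain ⟨β, hβN, hβ0, hβ⟩ := exists_ne_zero_mem_sub_one_mem hN0 hNk
  have hβ' := mem_coeIdeal_of_mem (𝓞 F)⁰ (P := F) hβN
  rw [hN] at hβ'
  obtain ⟨g, hg, e⟩ := mem_singleton_mul.1 hβ'
  have hd : g * ((y' : F) - y) ∈ (𝔨 : FractionalIdeal (𝓞 F)⁰ F) :=
    mul_mem_of_eq hg h (inv_mul_cancel_left₀ hJ _)
  obtain ⟨δ, hδ, eδ⟩ := (mem_coeIdeal _).1 hd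
  have hβc := isCoprime_span_of_sub_one_mem hβ
  refine ⟨β + δ, β, isCoprime_span_of_sub_mem hβc (by simpa using hδ), hβc, hβ0,
    by simpa using hδ, ?_⟩
  rw [map_add, eδ, e, Units.val_div_eq_div_val]
  have := y.ne_zero
  field_simp
  ring

end Congruences

/-! ### Approximation with prescribed signs -/

section Approximation

variable {F : Type*} [Field F] [NumberField F]

theorem exists_pos_nat_mul_mem {J : FractionalIdeal (𝓞 F)⁰ F} (hJ : J ≠ 0) {s : F} (hs : s ≠ 0) :
    ∃ N : ℕ, 0 < N ∧ (N : F) * s ∈ J := by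
  have hJs : spanSingleton (𝓞 F)⁰ s⁻¹ * J ≠ 0 :=
    mul_ne_zero (spanSingleton_ne_zero_iff.2 (inv_ne_zero hs)) hJ
  set L := spanSingleton (𝓞 F)⁰ s⁻¹ * J with hL
  have hnum : L.num ≠ ⊥ := fun h => hJs (num_eq_zero_iff.1 h)
  refine ⟨Ideal.absNorm L.num, Nat.pos_of_ne_zero (mt Ideal.absNorm_eq_zero_iff.1 hnum), ?_⟩
  have h1 : ((Ideal.absNorm L.num : ℕ) : F) ∈ L := by
    refine num_le L ?_
    have := mem_coeIdeal_of_mem (𝓞 F)⁰ (P := F) (Ideal.absNorm_mem L.num)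
    simpa using this
  obtain ⟨y, hy, e⟩ := mem_singleton_mul.1 h1
  rw [e, mul_right_comm, inv_mul_cancel₀ hs, one_mul]
  exact hy

/-- Every class modulo a nonzero fractional ideal contains units of `F` of any given signature: add
a large multiple of an element of that signature. -/
theorem exists_sub_mem_of_signature {J : FractionalIdeal (𝓞 F)⁰ F} (hJ : J ≠ 0) (y : F) (s : Fˣ) :
    ∃ y' : Fˣ, (y' : F) - y ∈ J ∧ y' / s ∈ totPos F := by
  obtain ⟨N, hN, hNs⟩ := exists_pos_nat_mul_mem hJ s.ne_zero
  have hNF : (N : F) ≠ 0 := Nat.cast_ne_zero.2 hN.ne'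
  have hpos : ∀ᶠ M : ℕ in Filter.atTop, ∀ φ : F →+* ℝ, 0 < φ (y / s + M * N) := by
    rw [Filter.eventually_all]
    intro φ
    have ht : Filter.Tendsto (fun M : ℕ => φ (y / s) + (M : ℝ) * N) Filter.atTop Filter.atTop :=
      Filter.tendsto_atTop_add_const_left _ _
        (tendsto_natCast_atTop_atTop.atTop_mul_const (by exact_mod_cast hN))
    filter_upwards [ht.eventually_gt_atTop 0] with M hM
    simpa using hM
  have hne : ∀ᶠ M : ℕ in Filter.atTop, y / s + (M : F) * N ≠ 0 := by
    rw [← Nat.cofinite_eq_atTop]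
    refine Set.Subsingleton.finite fun a ha b hb => ?_
    simp only [Set.mem_ofPred_eq, Set.mem_compl_iff, not_not] at ha hb
    have : ((a : F) - b) * N = 0 := by linear_combination ha - hb
    rcases mul_eq_zero.1 this with h | h
    · exact_mod_cast sub_eq_zero.1 h
    · exact absurd h hNF
  obtain ⟨M, hM, hM0⟩ := (hpos.and hne).exists
  have hs := s.ne_zero
  refine ⟨Units.mk0 (y / s + M * N) hM0 * s, ?_, ?_⟩
  · have e : ((Units.mk0 (y / s + M * N) hM0 * s : Fˣ) : F) - y = M • ((N : F) * s) := by
      rw [Units.val_mul, Units.val_mk0, nsmul_eq_mul]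
      field_simp
      ring
    rw [e]
    exact Submodule.smul_of_tower_mem (J : Submodule (𝓞 F) F) M hNs
  · rw [mul_div_cancel_right]
    exact hM

/-- Every signature is realized by an integer congruent to `1` modulo `𝔫`. -/
theorem exists_int_sub_one_mem_of_signature {𝔫 : Ideal (𝓞 F)} (hn : 𝔫 ≠ ⊥) (s : Fˣ) :
    ∃ (y : Fˣ) (y₀ : 𝓞 F), algebraMap (𝓞 F) F y₀ = y ∧ y₀ - 1 ∈ 𝔫 ∧ y / s ∈ totPos F := by
  obtain ⟨y, hy, hys⟩ := exists_sub_mem_of_signature (coeIdeal_ne_zero.2 hn :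
    (𝔫 : FractionalIdeal (𝓞 F)⁰ F) ≠ 0) 1 s
  obtain ⟨z, hz, e⟩ := (mem_coeIdeal _).1 hy
  exact ⟨y, z + 1, by rw [map_add, map_one, e]; ring, by simpa using hz, hys⟩

theorem int_mem_congrOne {𝔫 : Ideal (𝓞 F)} {y : Fˣ} {y₀ : 𝓞 F} (e : algebraMap (𝓞 F) F y₀ = y)
    (h : y₀ - 1 ∈ 𝔫) : y ∈ congrOne 𝔫 :=
  ⟨y₀, 1, isCoprime_span_of_sub_one_mem h, isCoprime_span_of_sub_one_mem (by simp), one_ne_zero, h,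
    by rw [e, map_one, mul_one]⟩

/-- Residues prime to `𝔪` lift to residues prime to a multiple of `𝔪`. -/
theorem exists_sub_mem_isCoprime {𝔪 J : Ideal (𝓞 F)} (hJ : J ≠ ⊥) (h : 𝔪 ∣ J) {z₀ : 𝓞 F}
    (hz : IsCoprime (Ideal.span {z₀}) 𝔪) :
    ∃ z : 𝓞 F, z ≠ 0 ∧ z - z₀ ∈ 𝔪 ∧ IsCoprime (Ideal.span {z}) J := by
  classical
  by_cases htop : J = ⊤
  · have hm : 𝔪 = ⊤ := top_le_iff.1 (htop ▸ Ideal.dvd_iff_le.1 h)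
    exact ⟨1, one_ne_zero, hm ▸ Submodule.mem_top, isCoprime_span_of_sub_one_mem (by simp)⟩
  -- the product of the primes dividing `J` but not `𝔪`
  let P := (Ideal.finite_factors (R := 𝓞 F) hJ).toFinset.filter fun v => ¬ v.asIdeal ∣ 𝔪
  let L := ∏ v ∈ P, v.asIdeal
  have hmL : IsCoprime 𝔪 L := by
    refine IsCoprime.prod_right fun v hv => ?_
    have hv' := (Finset.mem_filter.1 hv).2
    rw [Ideal.isCoprime_iff_sup_eq]
    by_contra hne
    refine hv' (Ideal.dvd_iff_le.2 ?_)
    rw [v.isMaximal.eq_of_le hne le_sup_right]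
    exact le_sup_left
  obtain ⟨i, hi, j, hj, e⟩ := Ideal.isCoprime_iff_exists.1 hmL
  have h1 : z₀ * j + i - z₀ ∈ 𝔪 := by
    have : z₀ * j + i - z₀ = (1 - z₀) * i := by linear_combination z₀ * e
    rw [this]
    exact 𝔪.mul_mem_left _ hi
  have h2 : z₀ * j + i - 1 ∈ L := by
    have : z₀ * j + i - 1 = (z₀ - 1) * j := by linear_combination e
    rw [this]
    exact L.mul_mem_left _ hj
  have hcop : IsCoprime (Ideal.span {z₀ * j + i}) J := by
    refine IsCoprime.symm ((isCoprime_iff_forall_heightOneSpectrum hJ).2 fun v hz' hvJ => ?_)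
    have hv : ¬ IsCoprime (Ideal.span {z₀ * j + i}) v.asIdeal := by
      rw [Ideal.isCoprime_iff_sup_eq, sup_eq_right.2 (Ideal.dvd_iff_le.1 hz')]
      exact v.isPrime.ne_top
    by_cases hvm : v.asIdeal ∣ 𝔪
    · exact hv ((isCoprime_span_of_sub_mem hz h1).of_isCoprime_of_dvd_right hvm)
    · have hvP : v ∈ P := Finset.mem_filter.2 ⟨by simpa using hvJ, hvm⟩
      exact hv ((isCoprime_span_of_sub_one_mem h2).of_isCoprime_of_dvd_right
        (Finset.dvd_prod_of_mem _ hvP))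
  refine ⟨z₀ * j + i, fun h0 => htop ?_, h1, hcop⟩
  rw [h0, Ideal.isCoprime_iff_sup_eq] at hcop
  simpa using hcop

/-- Every class of `G⁺_𝔪` contains an integral ideal prime to a given multiple `J` of `𝔪`. -/
theorem exists_mul_add_eq_one {𝔪 J : Ideal (𝓞 F)} (hJ : J ≠ ⊥) (h : 𝔪 ∣ J) {I : IdealGroup F}
    (hI : I ∈ coprimeIdeals 𝔪) :
    ∃ x ∈ totPos F ⊓ congrOne 𝔪,
      spanSingleton (𝓞 F)⁰ (x : F) * (I : FractionalIdeal (𝓞 F)⁰ F) + J = 1 := by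
  have hI0 : (I : FractionalIdeal (𝓞 F)⁰ F) ≠ 0 := I.ne_zero
  have hI1 : (I : FractionalIdeal (𝓞 F)⁰ F)⁻¹ ≠ 0 := inv_ne_zero hI0
  have hJ0 : (J : FractionalIdeal (𝓞 F)⁰ F) ≠ 0 := coeIdeal_ne_zero.2 hJ
  have hIJ : (I : FractionalIdeal (𝓞 F)⁰ F)⁻¹ * J ≠ 0 := mul_ne_zero hI1 hJ0
  have hJm : (J : FractionalIdeal (𝓞 F)⁰ F) ≤ (𝔪 : FractionalIdeal (𝓞 F)⁰ F) :=
    coeIdeal_le_coeIdeal F |>.2 (Ideal.dvd_iff_le.1 h)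
  have tfm : ∀ (L : FractionalIdeal (𝓞 F)⁰ F) (x : F),
      spanSingleton (𝓞 F)⁰ x * (I : FractionalIdeal (𝓞 F)⁰ F) + L = 1 ↔
        spanSingleton (𝓞 F)⁰ x + (I : FractionalIdeal (𝓞 F)⁰ F)⁻¹ * L =
          (I : FractionalIdeal (𝓞 F)⁰ F)⁻¹ := by
    intro L x
    rw [add_mul_eq_self_iff hI1, inv_inv]
  have toM : ∀ {L : FractionalIdeal (𝓞 F)⁰ F}, L + J = 1 → L + 𝔪 = 1 := by
    intro L hL
    refine le_antisymm (sup_le (hL ▸ le_sup_left) coeIdeal_le_one) ?_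
    rw [← hL]
    exact sup_le_sup_left hJm L
  -- a representative of the ideal class of `I` prime to `J`
  obtain ⟨y', hy'⟩ := IsDedekindDomain.exists_add_spanSingleton_mul_eq
    (coeIdeal_le_one : (J : FractionalIdeal (𝓞 F)⁰ F) ≤ 1) hJ0 hI0
  rw [add_comm, tfm] at hy'
  obtain ⟨y, hyy, -⟩ := exists_sub_mem_of_signature hIJ y' 1
  rw [← add_eq_of_sub_mem hyy, ← tfm] at hy'
  have hyI : toPrincipalIdeal (𝓞 F) F y * I ∈ coprimeIdeals 𝔪 := by
    apply mem_coprimeIdeals_of_add_eq_one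
    rw [Units.val_mul, coe_toPrincipalIdeal]
    exact toM hy'
  obtain ⟨α, β, hα, hβ, hβ0, e⟩ := exists_num_den_of_principal_mem
    (((coprimeIdeals 𝔪).mul_mem_cancel_right hI).1 hyI)
  -- correct it by an integer prime to `J`
  obtain ⟨γ, hγ, μ, hμ, e1⟩ := Ideal.isCoprime_iff_exists.1 hα
  obtain ⟨r, rfl⟩ := Ideal.mem_span_singleton'.1 hγ
  have hrβ : IsCoprime (Ideal.span {r * β}) 𝔪 := by
    rw [← Ideal.span_singleton_mul_span_singleton]
    refine IsCoprime.mul_left (Ideal.isCoprime_iff_exists.2 ⟨r * α, ?_, μ, hμ, e1⟩) hβ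
    exact Ideal.mul_mem_right _ _ (Ideal.mem_span_singleton_self r)
  obtain ⟨z, hz0, hz, hzJ⟩ := exists_sub_mem_isCoprime hJ h hrβ
  have hzF : algebraMap (𝓞 F) F z ≠ 0 := by rwa [Ne, FaithfulSMul.algebraMap_eq_zero_iff]
  have hx0 : Units.mk0 _ hzF * y ∈ congrOne 𝔪 := by
    refine ⟨z * α, β, ?_, hβ, hβ0, ?_, ?_⟩
    · rw [← Ideal.span_singleton_mul_span_singleton]
      exact (hzJ.of_isCoprime_of_dvd_right h).mul_left hα
    · have : z * α - β = α * (z - r * β) - β * μ := by linear_combination β * e1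
      rw [this]
      exact 𝔪.sub_mem (𝔪.mul_mem_left _ hz) (𝔪.mul_mem_left _ hμ)
    · rw [Units.val_mul, Units.val_mk0, mul_assoc, e, map_mul]
  have hx0J : spanSingleton (𝓞 F)⁰ ((Units.mk0 _ hzF * y : Fˣ) : F) *
      (I : FractionalIdeal (𝓞 F)⁰ F) + J = 1 := by
    rw [Units.val_mul, ← spanSingleton_mul_spanSingleton, mul_assoc]
    refine add_eq_one_of_mul ?_ hy'
    rw [Units.val_mk0, ← coeIdeal_span_singleton, coeIdeal_add_eq_one_iff]
    exact hzJ
  -- make it totally positive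
  obtain ⟨x, hx, hpos⟩ := exists_sub_mem_of_signature hIJ ((Units.mk0 _ hzF * y : Fˣ) : F) 1
  refine ⟨x, ⟨by simpa using hpos, ?_⟩, ?_⟩
  · have hdiv := div_mem_congrOne hI1 ((tfm _ _).1 (toM hx0J)) (mul_le_mul_right hJm _ hx)
    have := (congrOne 𝔪).mul_mem hdiv hx0
    rwa [div_mul_cancel] at this
  · rw [tfm, add_eq_of_sub_mem hx, ← tfm]
    exact hx0J

end Approximation

/-! ### Narrow ray class groups and the group `Q_{𝔪,𝔫}` -/

theorem relIndex_ne_zero_of_map {G X : Type*} [Group G] [Finite X] {H K : Subgroup G} (f : K → X)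
    (hf : ∀ x y : K, f x = f y → (x : G)⁻¹ * y ∈ H) : H.relIndex K ≠ 0 := by
  have : Finite (K ⧸ H.subgroupOf K) := by
    refine Finite.of_injective (fun q : K ⧸ H.subgroupOf K => f q.out) fun q q' h => ?_
    rw [← QuotientGroup.out_eq' q, ← QuotientGroup.out_eq' q', QuotientGroup.eq]
    exact hf _ _ h
  exact Subgroup.index_ne_zero_of_finite

section RayClassGroups

variable {F : Type*} [Field F] [NumberField F]

theorem totPos_relIndex_ne_zero (U : Subgroup Fˣ) : (totPos F).relIndex U ≠ 0 := by
  refine relIndex_ne_zero_of_map (X := (F →+* ℝ) → SignType)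
    (fun x φ => SignType.sign (φ ((x : Fˣ) : F))) fun x y h φ => ?_
  have hφ : SignType.sign (φ ((x : Fˣ) : F)) = SignType.sign (φ ((y : Fˣ) : F)) := congrFun h φ
  have hx : φ ((x : Fˣ) : F) ≠ 0 := (map_ne_zero φ).2 (Units.ne_zero _)
  rw [Units.val_mul, Units.val_inv_eq_inv_val, map_mul, map_inv₀]
  rcases lt_or_gt_of_ne hx with h0 | h0
  · rw [sign_neg h0] at hφ
    exact mul_pos_of_neg_of_neg (inv_lt_zero.2 h0) (sign_eq_neg_one_iff.1 hφ.symm)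
  · rw [sign_pos h0] at hφ
    exact mul_pos (inv_pos.2 h0) (sign_eq_one_iff.1 hφ.symm)

theorem congrOne_relIndex_ne_zero {𝔪 : Ideal (𝓞 F)} (hm : 𝔪 ≠ ⊥) :
    (congrOne 𝔪).relIndex ((coprimeIdeals 𝔪).comap (toPrincipalIdeal (𝓞 F) F)) ≠ 0 := by
  have : Finite (𝓞 F ⧸ 𝔪) := Ideal.finiteQuotientOfFreeOfNeBot 𝔪 hm
  have hex : ∀ x : (coprimeIdeals 𝔪).comap (toPrincipalIdeal (𝓞 F) F),
      ∃ α β : 𝓞 F, IsCoprime (Ideal.span {α}) 𝔪 ∧ IsCoprime (Ideal.span {β}) 𝔪 ∧ β ≠ 0 ∧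
      ((x : Fˣ) : F) * algebraMap (𝓞 F) F β = algebraMap (𝓞 F) F α := fun x =>
    exists_num_den_of_principal_mem x.2
  choose α β hα hβ h0 e using hex
  refine relIndex_ne_zero_of_map (X := (𝓞 F ⧸ 𝔪) × (𝓞 F ⧸ 𝔪))
    (fun x => (Ideal.Quotient.mk 𝔪 (α x), Ideal.Quotient.mk 𝔪 (β x))) fun x y h => ?_
  obtain ⟨h1, h2⟩ := Prod.ext_iff.1 h
  have h1' := Ideal.Quotient.eq.1 h1
  have h2' := Ideal.Quotient.eq.1 h2
  have hβF : ∀ z, algebraMap (𝓞 F) F (β z) ≠ 0 := fun z => by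
    rw [Ne, FaithfulSMul.algebraMap_eq_zero_iff]
    exact h0 z
  have hα0 : ∀ z, α z ≠ 0 := fun z hz => by
    have := e z
    rw [hz, map_zero] at this
    exact mul_ne_zero (Units.ne_zero _) (hβF z) this
  refine ⟨β x * α y, α x * β y, ?_, ?_, mul_ne_zero (hα0 x) (h0 y), ?_, ?_⟩
  · rw [← Ideal.span_singleton_mul_span_singleton]
    exact (hβ x).mul_left (hα y)
  · rw [← Ideal.span_singleton_mul_span_singleton]
    exact (hα x).mul_left (hβ y)
  · have : β x * α y - α x * β y = α y * (β x - β y) - β y * (α x - α y) := by ring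
    rw [this]
    exact 𝔪.sub_mem (𝔪.mul_mem_left _ h2') (𝔪.mul_mem_left _ h1')
  · rw [Units.val_mul, Units.val_inv_eq_inv_val, map_mul, map_mul, ← e x, ← e y]
    have := Units.ne_zero (x : Fˣ)
    field_simp

theorem finite_narrowRayClassGroup {𝔪 : Ideal (𝓞 F)} (hm : 𝔪 ≠ ⊥) :
    Finite (NarrowRayClassGroup 𝔪) := by
  set f := toPrincipalIdeal (𝓞 F) F with hf
  have h1 : f.range.relIndex (coprimeIdeals 𝔪) ≠ 0 := by
    have : Finite (IdealGroup F ⧸ f.range) :=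
      Finite.of_equiv _ (ClassGroup.equiv (R := 𝓞 F) F).toEquiv
    exact fun h => Subgroup.index_ne_zero_of_finite (H := f.range)
      (Subgroup.relIndex_top_right f.range ▸
        Subgroup.relIndex_eq_zero_of_le_right (le_top : coprimeIdeals 𝔪 ≤ ⊤) h)
  have h2 : ((totPos F ⊓ congrOne 𝔪).map f).relIndex (f.range ⊓ coprimeIdeals 𝔪) ≠ 0 := by
    rw [← Subgroup.map_comap_eq, ← Subgroup.relIndex_comap]
    exact mt (Subgroup.relIndex_eq_zero_of_le_left (Subgroup.le_comap_map f _))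
      (Subgroup.relIndex_inf_ne_zero (totPos_relIndex_ne_zero _) (congrOne_relIndex_ne_zero hm))
  have h3 : (f.range ⊓ coprimeIdeals 𝔪).relIndex (coprimeIdeals 𝔪) ≠ 0 := by
    rwa [Subgroup.inf_relIndex_right]
  exact Subgroup.index_ne_zero_iff_finite.1 (Subgroup.relIndex_ne_zero_trans h2 h3)

theorem idealDiv_dvd {𝔪 𝔫 : Ideal (𝓞 F)} (hn : 𝔫 ≠ ⊥) (h : 𝔪 ∣ 𝔫) : idealDiv 𝔫 𝔪 ∣ 𝔫 :=
  ⟨𝔪, by rw [mul_comm, mul_idealDiv hn h]⟩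

theorem finite_Q {𝔪 𝔫 : Ideal (𝓞 F)} (hn : 𝔫 ≠ ⊥) (h : 𝔪 ∣ 𝔫) : Finite (Q 𝔪 𝔫) := by
  have h1 := finite_narrowRayClassGroup (ne_zero_of_dvd_ne_zero hn h)
  have h2 := finite_narrowRayClassGroup (ne_zero_of_dvd_ne_zero hn (idealDiv_dvd hn h))
  infer_instance

theorem narrowRayClass_eq_iff {𝔪 : Ideal (𝓞 F)} {I I' : coprimeIdeals 𝔪} :
    (QuotientGroup.mk I : NarrowRayClassGroup 𝔪) = QuotientGroup.mk I' ↔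
      ∃ u ∈ totPos F ⊓ congrOne 𝔪,
        (I' : IdealGroup F) = I * toPrincipalIdeal (𝓞 F) F u := by
  rw [QuotientGroup.eq, Subgroup.mem_subgroupOf, Subgroup.mem_map]
  refine exists_congr fun u => and_congr_right fun _ => ?_
  rw [Subgroup.coe_mul, Subgroup.coe_inv, eq_inv_mul_iff_mul_eq, eq_comm]

/-- The diagonal subgroup consists of the classes of all principal ideals `(x)` with
`x ≡ 1 mod* 𝔫`: up to a totally positive factor `≡ 1 mod* 𝔫`, such an `x` is an integer `≡ 1`
modulo `𝔫`. -/
theorem mem_diagonalSubgroup_iff {𝔪 𝔫 : Ideal (𝓞 F)} (hn : 𝔫 ≠ ⊥) (h : 𝔪 ∣ 𝔫)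
    {g : NarrowRayClassGroup 𝔪 × NarrowRayClassGroup (idealDiv 𝔫 𝔪)} :
    g ∈ diagonalSubgroup 𝔪 𝔫 ↔ ∃ x ∈ congrOne 𝔫, ∃ (I : coprimeIdeals 𝔪)
      (J : coprimeIdeals (idealDiv 𝔫 𝔪)),
      (I : IdealGroup F) = toPrincipalIdeal (𝓞 F) F x ∧
      (J : IdealGroup F) = toPrincipalIdeal (𝓞 F) F x ∧
      g = (QuotientGroup.mk I, QuotientGroup.mk J) := by
  have hk := idealDiv_dvd hn h
  constructor
  · intro hg
    induction hg using Subgroup.closure_induction with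
    | mem g hg =>
      obtain ⟨x, x₀, I, J, e, hx, hI, hJ, rfl⟩ := hg
      exact ⟨x, int_mem_congrOne e hx, I, J, hI, hJ, rfl⟩
    | one => exact ⟨1, one_mem _, 1, 1, by simp, by simp, rfl⟩
    | mul g g' _ _ hg hg' =>
      obtain ⟨x, hx, I, J, hI, hJ, rfl⟩ := hg
      obtain ⟨x', hx', I', J', hI', hJ', rfl⟩ := hg'
      exact ⟨x * x', mul_mem hx hx', I * I', J * J', by simp [hI, hI'], by simp [hJ, hJ'], rfl⟩
    | inv g _ hg =>
      obtain ⟨x, hx, I, J, hI, hJ, rfl⟩ := hg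
      exact ⟨x⁻¹, inv_mem hx, I⁻¹, J⁻¹, by simp [hI], by simp [hJ], rfl⟩
  · rintro ⟨x, hx, I, J, hI, hJ, rfl⟩
    obtain ⟨y, y₀, e, hy, hpos⟩ := exists_int_sub_one_mem_of_signature hn x
    have hyc := int_mem_congrOne e hy
    have hmem : y / x ∈ totPos F ⊓ congrOne 𝔫 := ⟨hpos, (congrOne 𝔫).div_mem hyc hx⟩
    refine Subgroup.subset_closure ⟨y, y₀,
      ⟨_, principal_mem_coprimeIdeals (congrOne_mono h hyc)⟩,
      ⟨_, principal_mem_coprimeIdeals (congrOne_mono hk hyc)⟩, e, hy, rfl, rfl, ?_⟩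
    refine Prod.ext (narrowRayClass_eq_iff.2 ⟨y / x, ⟨hmem.1, congrOne_mono h hmem.2⟩, ?_⟩)
      (narrowRayClass_eq_iff.2 ⟨y / x, ⟨hmem.1, congrOne_mono hk hmem.2⟩, ?_⟩)
    · rw [hI, ← map_mul, mul_div_cancel]
    · rw [hJ, ← map_mul, mul_div_cancel]

/-- The class in `Q_{𝔪,𝔫}` of a pair of ideals. -/
noncomputable def Q.mk {𝔪 𝔫 : Ideal (𝓞 F)} (I : coprimeIdeals 𝔪) (J : coprimeIdeals (idealDiv 𝔫 𝔪)) :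
    Q 𝔪 𝔫 :=
  QuotientGroup.mk (QuotientGroup.mk I, QuotientGroup.mk J)

theorem Q.exists_mk_eq {𝔪 𝔫 : Ideal (𝓞 F)} (q : Q 𝔪 𝔫) :
    ∃ (I : coprimeIdeals 𝔪) (J : coprimeIdeals (idealDiv 𝔫 𝔪)), Q.mk I J = q := by
  obtain ⟨⟨i, j⟩, rfl⟩ := QuotientGroup.mk_surjective q
  obtain ⟨I, rfl⟩ := QuotientGroup.mk_surjective i
  obtain ⟨J, rfl⟩ := QuotientGroup.mk_surjective j
  exact ⟨I, J, rfl⟩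

theorem Q.mk_eq_mk_iff {𝔪 𝔫 : Ideal (𝓞 F)} (hn : 𝔫 ≠ ⊥) (h : 𝔪 ∣ 𝔫) {I I' : coprimeIdeals 𝔪}
    {J J' : coprimeIdeals (idealDiv 𝔫 𝔪)} :
    (Q.mk I J : Q 𝔪 𝔫) = Q.mk I' J' ↔
      ∃ x ∈ congrOne 𝔫, ∃ u ∈ totPos F ⊓ congrOne 𝔪, ∃ w ∈ totPos F ⊓ congrOne (idealDiv 𝔫 𝔪),
        (I' : IdealGroup F) = I * toPrincipalIdeal (𝓞 F) F (x * u) ∧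
        (J' : IdealGroup F) = J * toPrincipalIdeal (𝓞 F) F (x * w) := by
  have hk := idealDiv_dvd hn h
  rw [Q.mk, Q.mk, QuotientGroup.eq, mem_diagonalSubgroup_iff hn h]
  refine exists_congr fun x => and_congr_right fun hx => ?_
  constructor
  · rintro ⟨X, Y, hX, hY, e⟩
    rw [inv_mul_eq_iff_eq_mul, Prod.mk_mul_mk, ← QuotientGroup.mk_mul, ← QuotientGroup.mk_mul] at e
    obtain ⟨e1, e2⟩ := Prod.ext_iff.1 e.symm
    obtain ⟨u, hu, h1⟩ := narrowRayClass_eq_iff.1 e1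
    obtain ⟨w, hw, h2⟩ := narrowRayClass_eq_iff.1 e2
    refine ⟨u, hu, w, hw, ?_, ?_⟩
    · rw [h1, Subgroup.coe_mul, hX, map_mul, mul_assoc]
    · rw [h2, Subgroup.coe_mul, hY, map_mul, mul_assoc]
  · rintro ⟨u, hu, w, hw, h1, h2⟩
    refine ⟨⟨_, principal_mem_coprimeIdeals (congrOne_mono h hx)⟩,
      ⟨_, principal_mem_coprimeIdeals (congrOne_mono hk hx)⟩, rfl, rfl, ?_⟩
    rw [inv_mul_eq_iff_eq_mul, Prod.mk_mul_mk, ← QuotientGroup.mk_mul, ← QuotientGroup.mk_mul]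
    refine Eq.symm (Prod.ext (narrowRayClass_eq_iff.2 ⟨u, hu, ?_⟩)
      (narrowRayClass_eq_iff.2 ⟨w, hw, ?_⟩))
    · rw [h1, Subgroup.coe_mul, map_mul, mul_assoc]
    · rw [h2, Subgroup.coe_mul, map_mul, mul_assoc]

end RayClassGroups

/-! ### The action of `Γ_{1,λ}(𝔫)` on columns -/

section CuspColumns

variable {F : Type*} [Field F] [NumberField F]

theorem GL2Plus_mul_apply (A B : GL2Plus F) (i j : Fin 2) :
    (A * B).1 i j = A.1 i 0 * B.1 0 j + A.1 i 1 * B.1 1 j := by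
  change (A.1 * B.1) i j = _
  simp [Matrix.mul_apply, Fin.sum_univ_two]

theorem GL2Plus_det (A : GL2Plus F) :
    (A.1.det : F) = A.1 0 0 * A.1 1 1 - A.1 0 1 * A.1 1 0 := by
  rw [Matrix.GeneralLinearGroup.val_det_apply, Matrix.det_fin_two]

theorem GL2Plus_column_ne_zero (A : GL2Plus F) : A.1 0 0 ≠ 0 ∨ A.1 1 0 ≠ 0 := by
  by_contra! h
  have := GL2Plus_det A
  rw [h.1, h.2, zero_mul, mul_zero, sub_zero] at this
  exact A.1.det.ne_zero this

/-- A matrix of totally positive determinant with prescribed entries. -/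
theorem exists_GL2Plus (p q r s : F) (e : Fˣ) (he : e ∈ totPos F) (h : p * s - q * r = e) :
    ∃ A : GL2Plus F, A.1 0 0 = p ∧ A.1 0 1 = q ∧ A.1 1 0 = r ∧ A.1 1 1 = s ∧ A.1.det = e := by
  have hdet : (!![p, q; r, s]).det = e := by rw [Matrix.det_fin_two_of, h]
  have hne : (!![p, q; r, s]).det ≠ 0 := hdet ▸ e.ne_zero
  have hd : (Matrix.GeneralLinearGroup.mkOfDetNeZero _ hne).det = e := by
    ext
    exact hdet
  exact ⟨⟨Matrix.GeneralLinearGroup.mkOfDetNeZero _ hne, by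
    rw [GL2Plus, Subgroup.mem_comap, hd]; exact he⟩, rfl, rfl, rfl, rfl, hd⟩

/-- Two matrices represent the same cusp exactly when their first columns are related by
`Γ_{1,λ}(𝔫)` up to a scalar. -/
theorem cusp_eq_iff {𝔱 : NarrowClassGroup F → IdealGroup F} {𝔫 : Ideal (𝓞 F)} {A A' : GL2Plus F}
    {l : NarrowClassGroup F} :
    cusp 𝔱 𝔫 A l = cusp 𝔱 𝔫 A' l ↔ ∃ γ ∈ Gamma1 (𝔱 l) 𝔫, ∃ ρ : F, ρ ≠ 0 ∧
      A'.1 0 0 = ρ * (γ.1 0 0 * A.1 0 0 + γ.1 0 1 * A.1 1 0) ∧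
      A'.1 1 0 = ρ * (γ.1 1 0 * A.1 0 0 + γ.1 1 1 * A.1 1 0) := by
  have hmk : cusp 𝔱 𝔫 A l = cusp 𝔱 𝔫 A' l ↔
      DoubleCoset.mk (Gamma1 (𝔱 l) 𝔫) (borel F) A =
        DoubleCoset.mk (Gamma1 (𝔱 l) 𝔫) (borel F) A' := by
    constructor
    · exact fun h => eq_of_heq (Sigma.mk.inj h).2
    · exact fun h => congrArg (Sigma.mk l) h
  rw [hmk, DoubleCoset.eq]
  refine exists_congr fun γ => and_congr_right fun _ => ?_
  constructor
  · rintro ⟨β, hβ, rfl⟩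
    have hβ' : β.1 1 0 = 0 := hβ
    refine ⟨β.1 0 0, ?_, ?_, ?_⟩
    · have := GL2Plus_column_ne_zero β
      tauto
    · rw [GL2Plus_mul_apply, GL2Plus_mul_apply γ A, hβ']
      ring
    · rw [GL2Plus_mul_apply, GL2Plus_mul_apply γ A, hβ']
      ring
  · rintro ⟨ρ, -, h0, h1⟩
    refine ⟨(γ * A)⁻¹ * A', ?_, by group⟩
    change ((γ * A)⁻¹ * A').1 1 0 = 0
    rw [GL2Plus_mul_apply]
    have hi := (inv_entries (γ * A).1).2
    have e : (((γ * A)⁻¹ : GL2Plus F) : GL (Fin 2) F) = (γ * A).1⁻¹ := rfl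
    rw [e, hi.1, hi.2, GL2Plus_mul_apply γ A, GL2Plus_mul_apply γ A, h0, h1]
    ring

theorem fst_eq_of_cusp_eq {𝔱 : NarrowClassGroup F → IdealGroup F} {𝔫 : Ideal (𝓞 F)}
    {A A' : GL2Plus F} {l l' : NarrowClassGroup F} (h : cusp 𝔱 𝔫 A l = cusp 𝔱 𝔫 A' l') : l = l' :=
  congrArg Sigma.fst h

theorem exists_unit_of_principal_eq_one {x : Fˣ} (h : toPrincipalIdeal (𝓞 F) F x = 1) :
    ∃ u : (𝓞 F)ˣ, (x : F) = algebraMap (𝓞 F) F u := by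
  have h1 : spanSingleton (𝓞 F)⁰ (x : F) = 1 := toPrincipalIdeal_eq_iff.1 h
  have h2 : spanSingleton (𝓞 F)⁰ ((x⁻¹ : Fˣ) : F) = 1 :=
    toPrincipalIdeal_eq_iff.1 (by rw [map_inv, h, inv_one])
  obtain ⟨y, hy⟩ := (mem_one_iff _).1 (h1 ▸ mem_spanSingleton_self (𝓞 F)⁰ (x : F))
  obtain ⟨z, hz⟩ := (mem_one_iff _).1 (h2 ▸ mem_spanSingleton_self (𝓞 F)⁰ ((x⁻¹ : Fˣ) : F))
  have hyz : y * z = 1 := by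
    apply FaithfulSMul.algebraMap_injective (𝓞 F) F
    rw [map_mul, hy, hz, map_one, Units.mul_inv]
  exact ⟨⟨y, z, hyz, by rw [mul_comm, hyz]⟩, hy.symm⟩

theorem spanSingleton_unit (u : (𝓞 F)ˣ) :
    spanSingleton (𝓞 F)⁰ (algebraMap (𝓞 F) F u) = 1 := by
  rw [← coeIdeal_span_singleton, Ideal.span_singleton_eq_top.2 u.isUnit, coeIdeal_top]

theorem Gamma1_columnIdeal {𝔱 : IdealGroup F} {𝔫 : Ideal (𝓞 F)} {γ : GL2Plus F}
    (hγ : γ ∈ Gamma1 𝔱 𝔫) (a c : F) :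
    columnIdeal (tdIdeal 𝔱) (γ.1 0 0 * a + γ.1 0 1 * c) (γ.1 1 0 * a + γ.1 1 1 * c) =
      columnIdeal (tdIdeal 𝔱) a c := by
  have hT := tdIdeal_ne_zero 𝔱
  have key : ∀ {γ : GL2Plus F}, γ ∈ Gamma1 𝔱 𝔫 → ∀ a c : F,
      columnIdeal (tdIdeal 𝔱) (γ.1 0 0 * a + γ.1 0 1 * c) (γ.1 1 0 * a + γ.1 1 1 * c) ≤
        columnIdeal (tdIdeal 𝔱) a c := by
    intro γ hγ a c
    obtain ⟨ha, hd, hc, hb, -, -⟩ := hγ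
    exact columnIdeal_matrix_le hT ha hb (fracIdeal_mul_le_self coeIdeal_le_one hc) hd
  refine le_antisymm (key hγ a c) ?_
  have h := key ((Gamma1 𝔱 𝔫).inv_mem hγ) (γ.1 0 0 * a + γ.1 0 1 * c) (γ.1 1 0 * a + γ.1 1 1 * c)
  have e : ∀ i j, (γ⁻¹).1 i 0 * γ.1 0 j + (γ⁻¹).1 i 1 * γ.1 1 j = (1 : GL (Fin 2) F) i j := by
    intro i j
    rw [← GL2Plus_mul_apply, inv_mul_cancel]
    rfl
  have e00 := e 0 0
  have e01 := e 0 1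
  have e10 := e 1 0
  have e11 := e 1 1
  simp only [Units.val_one, Matrix.one_apply, Fin.isValue, if_true, zero_ne_one, one_ne_zero,
    if_false] at e00 e01 e10 e11
  convert! h using 2
  · linear_combination -(a * e00) - c * e01
  · linear_combination -(a * e10) - c * e11

/-- The action of `Γ_{1,λ}(𝔫)` fixes the lower entry of a column modulo `T𝔟𝔫`. -/
theorem Gamma1_lower_sub_mem {𝔱 : IdealGroup F} {𝔫 : Ideal (𝓞 F)} {γ : GL2Plus F}
    (hγ : γ ∈ Gamma1 𝔱 𝔫) (a c : F) :
    γ.1 1 0 * a + γ.1 1 1 * c - c ∈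
      tdIdeal 𝔱 * columnIdeal (tdIdeal 𝔱) a c * (𝔫 : FractionalIdeal (𝓞 F)⁰ F) := by
  obtain ⟨-, -, hr, -, -, hs⟩ := hγ
  obtain ⟨ha, hc⟩ := (columnIdeal_le_iff (tdIdeal_ne_zero 𝔱)).1
    (le_refl (columnIdeal (tdIdeal 𝔱) a c))
  have : γ.1 1 0 * a + γ.1 1 1 * c - c = γ.1 1 0 * a + (γ.1 1 1 - 1) * c := by ring
  rw [this]
  exact Submodule.add_mem _ (mul_mem_of_eq hr ha (by ring)) (mul_mem_of_eq hs hc (by ring))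

theorem Gamma1_levelIdeal {𝔱 : IdealGroup F} {𝔫 : Ideal (𝓞 F)} {γ : GL2Plus F}
    (hγ : γ ∈ Gamma1 𝔱 𝔫) {a c : F} (h : a ≠ 0 ∨ c ≠ 0) :
    levelIdeal (tdIdeal 𝔱) 𝔫 (γ.1 0 0 * a + γ.1 0 1 * c) (γ.1 1 0 * a + γ.1 1 1 * c) =
      levelIdeal (tdIdeal 𝔱) (𝔫 : FractionalIdeal (𝓞 F)⁰ F) a c := by
  have hT := tdIdeal_ne_zero 𝔱
  have hb := columnIdeal_ne_zero hT h
  refine mul_left_cancel₀ (mul_ne_zero hT hb) ?_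
  rw [← span_add_of_levelIdeal hT h, ← add_eq_of_sub_mem (Gamma1_lower_sub_mem hγ a c), levelIdeal,
    Gamma1_columnIdeal hγ, mul_add, mul_left_comm, mul_inv_cancel₀ (mul_ne_zero hT hb), mul_one]

theorem mIdeal_eq_of_cusp_eq {𝔱 : NarrowClassGroup F → IdealGroup F} {𝔫 : Ideal (𝓞 F)}
    {A A' : GL2Plus F} {l l' : NarrowClassGroup F} (h : cusp 𝔱 𝔫 A l = cusp 𝔱 𝔫 A' l') :
    mIdeal (𝔱 l) 𝔫 A = mIdeal (𝔱 l') 𝔫 A' := by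
  obtain rfl := fst_eq_of_cusp_eq h
  obtain ⟨γ, hγ, ρ, hρ, h0, h1⟩ := cusp_eq_iff.1 h
  change levelIdeal _ _ _ _ = levelIdeal _ _ _ _
  rw [h0, h1, levelIdeal_smul _ _ hρ, Gamma1_levelIdeal hγ (GL2Plus_column_ne_zero A)]

/-- The action of `Γ_{1,λ}(𝔫)` multiplies the upper entry of a column by the determinant,
modulo `𝔟𝔪`. -/
theorem Gamma1_upper_sub_mem {𝔱 : IdealGroup F} {𝔫 : Ideal (𝓞 F)} {γ : GL2Plus F}
    (hγ : γ ∈ Gamma1 𝔱 𝔫) {a c : F} (h : a ≠ 0 ∨ c ≠ 0) :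
    γ.1 0 0 * a + γ.1 0 1 * c - (γ.1.det : F) * a ∈ columnIdeal (tdIdeal 𝔱) a c *
      levelIdeal (tdIdeal 𝔱) (𝔫 : FractionalIdeal (𝓞 F)⁰ F) a c := by
  obtain ⟨hp, -, hr, hq, -, hs⟩ := hγ
  have hT := tdIdeal_ne_zero 𝔱
  set b := columnIdeal (tdIdeal 𝔱) a c with hb
  set m := levelIdeal (tdIdeal 𝔱) (𝔫 : FractionalIdeal (𝓞 F)⁰ F) a c with hm
  have hnm : (𝔫 : FractionalIdeal (𝓞 F)⁰ F) ≤ m := le_sup_right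
  obtain ⟨ha, -⟩ := (columnIdeal_le_iff hT).1 (le_refl b)
  have hc : c ∈ tdIdeal 𝔱 * b * m := by
    rw [hm, hb, ← span_add_of_levelIdeal hT h]
    exact (le_sup_left : _ ≤ spanSingleton (𝓞 F)⁰ c + tdIdeal 𝔱 * b * 𝔫)
      (mem_spanSingleton_self _ _)
  have : γ.1 0 0 * a + γ.1 0 1 * c - (γ.1.det : F) * a =
      γ.1 0 1 * c + (γ.1 0 1 * γ.1 1 0 - γ.1 0 0 * (γ.1 1 1 - 1)) * a := by
    rw [GL2Plus_det]
    ring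
  rw [this]
  refine Submodule.add_mem _ (mul_mem_of_eq hq hc (by field_simp)) ?_
  exact mul_mem_of_eq (hnm (Submodule.sub_mem _ (upper_mul_lower hq hr) (int_mul_mem hp hs))) ha
    (by ring)

/-- Conversely, columns with the same ideal and level, whose lower entries agree modulo `T𝔟𝔫` and
whose upper entries agree modulo `𝔟𝔪` up to a totally positive unit, are related by
`Γ_{1,λ}(𝔫)`. -/
theorem exists_Gamma1_of_congr {𝔱 : IdealGroup F} {𝔫 : Ideal (𝓞 F)} {a c a' c' : F}
    (h0 : a ≠ 0 ∨ c ≠ 0)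
    {e : Fˣ} (he : e ∈ totPos F) (he1 : toPrincipalIdeal (𝓞 F) F e = 1)
    (h : columnIdeal (tdIdeal 𝔱) a' c' = columnIdeal (tdIdeal 𝔱) a c)
    (hc : c' - c ∈ tdIdeal 𝔱 * columnIdeal (tdIdeal 𝔱) a c * (𝔫 : FractionalIdeal (𝓞 F)⁰ F))
    (ha : a' - e * a ∈ columnIdeal (tdIdeal 𝔱) a c *
      levelIdeal (tdIdeal 𝔱) (𝔫 : FractionalIdeal (𝓞 F)⁰ F) a c) :
    ∃ γ ∈ Gamma1 𝔱 𝔫, γ.1 0 0 * a + γ.1 0 1 * c = a' ∧ γ.1 1 0 * a + γ.1 1 1 * c = c' := by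
  have hT := tdIdeal_ne_zero 𝔱
  obtain ⟨u, hu⟩ := exists_unit_of_principal_eq_one he1
  have he' : (e : F) ∈ (1 : FractionalIdeal (𝓞 F)⁰ F) := hu ▸ coe_mem_one _ _
  have hcol : columnIdeal (tdIdeal 𝔱) (e * a) c = columnIdeal (tdIdeal 𝔱) a c := by
    rw [columnIdeal, ← spanSingleton_mul_spanSingleton, hu, spanSingleton_unit, one_mul,
      columnIdeal]
  obtain ⟨p, q, r, s, hp, hs, hr, hq, hdet, hs1, e1, e2⟩ :=
    exists_matrix_of_congr hT (columnIdeal_ne_zero hT h0) hcol h rfl hc ha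
  obtain ⟨γ, h00, h01, h10, h11, hd⟩ := exists_GL2Plus (p * e) q (r * e) s e he
    (by linear_combination (e : F) * hdet)
  refine ⟨γ, ⟨?_, ?_, ?_, ?_, ⟨u, ?_⟩, ?_⟩, ?_, ?_⟩
  · rw [h00]
    exact int_mul_mem hp he'
  · rwa [h11]
  · rw [h10, mul_comm r]
    exact int_mul_mem he' hr
  · rwa [h01]
  · rw [hd, hu]
  · rwa [h11]
  · rw [h00, h01, ← e1]
    ring
  · rw [h10, h11, ← e2]
    ring

end CuspColumns

/-! ### Pairs of ideals attached to a column -/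

section RayClassesOfCusps

variable {F : Type*} [Field F] [NumberField F]

/-- The pair `(I, J)` of fractional ideals is attached to the column `(a, c)`: there are
`α ≡ a mod 𝔟𝔪` and `χ ≡ c mod T𝔟𝔫` in `Fˣ`, of the same signature, with `I = α𝔟⁻¹` and
`J = χ(T𝔟𝔪)⁻¹`. Asking only for equal signatures, rather than for total positivity, makes the
relation invariant under scaling the column by `Fˣ`. -/
def IsAttached (𝔱 : IdealGroup F) (𝔪 𝔫 : Ideal (𝓞 F)) (a c : F) (I J : IdealGroup F) : Prop :=
  ∃ α χ : Fˣ, α / χ ∈ totPos F ∧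
    (α : F) - a ∈ columnIdeal (tdIdeal 𝔱) a c * (𝔪 : FractionalIdeal (𝓞 F)⁰ F) ∧
    (χ : F) - c ∈ tdIdeal 𝔱 * columnIdeal (tdIdeal 𝔱) a c * (𝔫 : FractionalIdeal (𝓞 F)⁰ F) ∧
    spanSingleton (𝓞 F)⁰ (α : F) = I * columnIdeal (tdIdeal 𝔱) a c ∧
    spanSingleton (𝓞 F)⁰ (χ : F) = J * (tdIdeal 𝔱 * columnIdeal (tdIdeal 𝔱) a c * 𝔪)

variable {𝔱 : IdealGroup F} {𝔪 𝔫 : Ideal (𝓞 F)} {a c : F} {I J : IdealGroup F}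

theorem IsAttached.smul (h : IsAttached 𝔱 𝔪 𝔫 a c I J) (ρ : Fˣ) :
    IsAttached 𝔱 𝔪 𝔫 (ρ * a) (ρ * c) I J := by
  obtain ⟨α, χ, hs, hα, hχ, hI, hJ⟩ := h
  refine ⟨ρ * α, ρ * χ, by rwa [mul_div_mul_left_eq_div], ?_, ?_, ?_, ?_⟩
  · rw [columnIdeal_smul, Units.val_mul, ← mul_sub, mul_assoc]
    exact mul_mem_mul (mem_spanSingleton_self _ _) hα
  · rw [columnIdeal_smul, Units.val_mul, ← mul_sub]
    exact mul_mem_of_eq (mem_spanSingleton_self _ _) hχ (by ring)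
  · rw [columnIdeal_smul, Units.val_mul, ← spanSingleton_mul_spanSingleton, hI]
    ring
  · rw [columnIdeal_smul, Units.val_mul, ← spanSingleton_mul_spanSingleton, hJ]
    ring

theorem IsAttached.gamma (h : IsAttached 𝔱 𝔪 𝔫 a c I J) (h0 : a ≠ 0 ∨ c ≠ 0)
    (hm : levelIdeal (tdIdeal 𝔱) (𝔫 : FractionalIdeal (𝓞 F)⁰ F) a c = 𝔪)
    {γ : GL2Plus F} (hγ : γ ∈ Gamma1 𝔱 𝔫) :
    IsAttached 𝔱 𝔪 𝔫 (γ.1 0 0 * a + γ.1 0 1 * c) (γ.1 1 0 * a + γ.1 1 1 * c) I J := by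
  obtain ⟨α, χ, hs, hα, hχ, hI, hJ⟩ := h
  obtain ⟨u, hu⟩ := hγ.2.2.2.2.1
  have hupper := Gamma1_upper_sub_mem hγ h0
  have hlower := Gamma1_lower_sub_mem hγ a c
  rw [hm] at hupper
  refine ⟨γ.1.det * α, χ, ?_, ?_, ?_, ?_, ?_⟩
  · rw [mul_div_assoc]
    exact (totPos F).mul_mem γ.2 hs
  · rw [Gamma1_columnIdeal hγ, Units.val_mul]
    have e : (γ.1.det : F) * α - (γ.1 0 0 * a + γ.1 0 1 * c) =
      (γ.1.det : F) * (α - a) - (γ.1 0 0 * a + γ.1 0 1 * c - (γ.1.det : F) * a) := by ring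
    rw [e, hu]
    exact Submodule.sub_mem _ (int_mul_mem (coe_mem_one _ _) hα) (hu ▸ hupper)
  · rw [Gamma1_columnIdeal hγ]
    have e : (χ : F) - (γ.1 1 0 * a + γ.1 1 1 * c) =
      (χ - c) - (γ.1 1 0 * a + γ.1 1 1 * c - c) := by ring
    rw [e]
    exact Submodule.sub_mem _ hχ hlower
  · rw [Gamma1_columnIdeal hγ, Units.val_mul, ← spanSingleton_mul_spanSingleton, hu,
      spanSingleton_unit, one_mul, hI]
  · rw [Gamma1_columnIdeal hγ, hJ]

theorem exists_isAttached (hn : 𝔫 ≠ ⊥) (hmn : 𝔪 ∣ 𝔫) (h0 : a ≠ 0 ∨ c ≠ 0) :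
    ∃ I J, IsAttached 𝔱 𝔪 𝔫 a c I J := by
  have hT := tdIdeal_ne_zero 𝔱
  have hb := columnIdeal_ne_zero hT h0
  have hm0 : (𝔪 : FractionalIdeal (𝓞 F)⁰ F) ≠ 0 :=
    coeIdeal_ne_zero.2 (ne_zero_of_dvd_ne_zero hn hmn)
  have hn0 : (𝔫 : FractionalIdeal (𝓞 F)⁰ F) ≠ 0 := coeIdeal_ne_zero.2 hn
  obtain ⟨α, hα, hα'⟩ := exists_sub_mem_of_signature (mul_ne_zero hb hm0) a 1
  obtain ⟨χ, hχ, hχ'⟩ := exists_sub_mem_of_signature (mul_ne_zero (mul_ne_zero hT hb) hn0) c 1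
  refine ⟨toPrincipalIdeal (𝓞 F) F α / Units.mk0 _ hb,
    toPrincipalIdeal (𝓞 F) F χ / Units.mk0 _ (mul_ne_zero (mul_ne_zero hT hb) hm0),
    α, χ, ?_, hα, hχ, ?_, ?_⟩
  · have := (totPos F).div_mem hα' hχ'
    rwa [_root_.div_one, _root_.div_one] at this
  · rw [Units.val_div_eq_div_val, Units.val_mk0, div_mul_cancel₀ _ hb, coe_toPrincipalIdeal]
  · rw [Units.val_div_eq_div_val, Units.val_mk0,
      div_mul_cancel₀ _ (mul_ne_zero (mul_ne_zero hT hb) hm0), coe_toPrincipalIdeal]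

theorem coe_mul_idealDiv (hn : 𝔫 ≠ ⊥) (hmn : 𝔪 ∣ 𝔫) :
    (𝔪 : FractionalIdeal (𝓞 F)⁰ F) * (idealDiv 𝔫 𝔪 : Ideal (𝓞 F)) = 𝔫 := by
  rw [← coeIdeal_mul, mul_idealDiv hn hmn]

/-- The element `α` generates `𝔟` modulo `𝔟𝔪`. -/
theorem upper_span_add (h0 : a ≠ 0 ∨ c ≠ 0)
    (hm : levelIdeal (tdIdeal 𝔱) (𝔫 : FractionalIdeal (𝓞 F)⁰ F) a c = 𝔪) {α : F}
    (hα : α - a ∈ columnIdeal (tdIdeal 𝔱) a c * (𝔪 : FractionalIdeal (𝓞 F)⁰ F)) :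
    spanSingleton (𝓞 F)⁰ α + columnIdeal (tdIdeal 𝔱) a c * 𝔪 = columnIdeal (tdIdeal 𝔱) a c := by
  rw [add_eq_of_sub_mem hα, ← hm]
  exact span_add_mul_levelIdeal (tdIdeal_ne_zero 𝔱) coeIdeal_le_one h0

/-- The element `χ` generates `T𝔟𝔪` modulo `T𝔟𝔫`. -/
theorem lower_span_add (hn : 𝔫 ≠ ⊥) (hmn : 𝔪 ∣ 𝔫) (h0 : a ≠ 0 ∨ c ≠ 0)
    (hm : levelIdeal (tdIdeal 𝔱) (𝔫 : FractionalIdeal (𝓞 F)⁰ F) a c = 𝔪) {χ : F}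
    (hχ : χ - c ∈ tdIdeal 𝔱 * columnIdeal (tdIdeal 𝔱) a c * (𝔫 : FractionalIdeal (𝓞 F)⁰ F)) :
    spanSingleton (𝓞 F)⁰ χ +
      tdIdeal 𝔱 * columnIdeal (tdIdeal 𝔱) a c * 𝔪 * (idealDiv 𝔫 𝔪 : Ideal (𝓞 F)) =
      tdIdeal 𝔱 * columnIdeal (tdIdeal 𝔱) a c * 𝔪 := by
  rw [mul_assoc _ (𝔪 : FractionalIdeal (𝓞 F)⁰ F), coe_mul_idealDiv hn hmn, add_eq_of_sub_mem hχ,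
    ← hm]
  exact span_add_of_levelIdeal (tdIdeal_ne_zero 𝔱) h0

theorem IsAttached.mem_coprimeIdeals (h : IsAttached 𝔱 𝔪 𝔫 a c I J) (hn : 𝔫 ≠ ⊥) (hmn : 𝔪 ∣ 𝔫)
    (h0 : a ≠ 0 ∨ c ≠ 0)
    (hm : levelIdeal (tdIdeal 𝔱) (𝔫 : FractionalIdeal (𝓞 F)⁰ F) a c = 𝔪) :
    I ∈ coprimeIdeals 𝔪 ∧ J ∈ coprimeIdeals (idealDiv 𝔫 𝔪) := by
  have hT := tdIdeal_ne_zero 𝔱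
  have hb := columnIdeal_ne_zero hT h0
  have hm0 : (𝔪 : FractionalIdeal (𝓞 F)⁰ F) ≠ 0 :=
    coeIdeal_ne_zero.2 (ne_zero_of_dvd_ne_zero hn hmn)
  have hTbm := mul_ne_zero (mul_ne_zero hT hb) hm0
  obtain ⟨α, χ, -, hα, hχ, hI, hJ⟩ := h
  constructor
  · apply mem_coprimeIdeals_of_add_eq_one
    have := upper_span_add h0 hm hα
    rwa [add_mul_eq_self_iff hb, hI, mul_inv_cancel_right₀ hb] at this
  · apply mem_coprimeIdeals_of_add_eq_one
    have := lower_span_add hn hmn h0 hm hχ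
    rwa [add_mul_eq_self_iff hTbm, hJ, mul_inv_cancel_right₀ hTbm] at this

/-- Any two pairs attached to the same column have the same class in `Q_{𝔪,𝔫}`. Their quotients
are `α'/α ≡ 1 mod* 𝔪` and `χ'/χ ≡ 1 mod* 𝔫/𝔪`, of the same signature; an integer `≡ 1` modulo `𝔫`
of this signature accounts for the signs. -/
theorem IsAttached.mk_eq_mk (hn : 𝔫 ≠ ⊥) (hmn : 𝔪 ∣ 𝔫) (h0 : a ≠ 0 ∨ c ≠ 0)
    (hm : levelIdeal (tdIdeal 𝔱) (𝔫 : FractionalIdeal (𝓞 F)⁰ F) a c = 𝔪)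
    {I I' : coprimeIdeals 𝔪} {J J' : coprimeIdeals (idealDiv 𝔫 𝔪)}
    (h : IsAttached 𝔱 𝔪 𝔫 a c I J) (h' : IsAttached 𝔱 𝔪 𝔫 a c I' J') :
    (Q.mk I J : Q 𝔪 𝔫) = Q.mk I' J' := by
  have hT := tdIdeal_ne_zero 𝔱
  have hb := columnIdeal_ne_zero hT h0
  have hm0 : (𝔪 : FractionalIdeal (𝓞 F)⁰ F) ≠ 0 :=
    coeIdeal_ne_zero.2 (ne_zero_of_dvd_ne_zero hn hmn)
  have hTbm := mul_ne_zero (mul_ne_zero hT hb) hm0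
  obtain ⟨α, χ, hs, hα, hχ, hI, hJ⟩ := h
  obtain ⟨α', χ', hs', hα', hχ', hI', hJ'⟩ := h'
  have hαα : α' / α ∈ congrOne 𝔪 := by
    refine div_mem_congrOne hb (upper_span_add h0 hm hα) ?_
    have := Submodule.sub_mem _ hα' hα
    rwa [sub_sub_sub_cancel_right] at this
  have hχχ : χ' / χ ∈ congrOne (idealDiv 𝔫 𝔪) := by
    refine div_mem_congrOne hTbm (lower_span_add hn hmn h0 hm hχ) ?_
    have := Submodule.sub_mem _ hχ' hχ
    rw [mul_assoc _ (𝔪 : FractionalIdeal (𝓞 F)⁰ F), coe_mul_idealDiv hn hmn]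
    rwa [sub_sub_sub_cancel_right] at this
  obtain ⟨y, y₀, hy, hy1, hypos⟩ := exists_int_sub_one_mem_of_signature hn (α' / α)
  have hyc := int_mem_congrOne hy hy1
  have hpos1 : α' / α / y ∈ totPos F := by
    have := (totPos F).inv_mem hypos
    rwa [inv_div] at this
  refine (Q.mk_eq_mk_iff hn hmn).2 ⟨y, hyc, α' / α / y,
    ⟨hpos1, (congrOne 𝔪).div_mem hαα (congrOne_mono hmn hyc)⟩, χ' / χ / y,
    ⟨?_, (congrOne _).div_mem hχχ (congrOne_mono (idealDiv_dvd hn hmn) hyc)⟩, ?_, ?_⟩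
  · have e : χ' / χ / y = α' / α / y * (α / χ) / (α' / χ') := by
      rw [div_div_eq_mul_div, eq_div_iff_mul_eq']
      simp only [div_eq_mul_inv, mul_comm, mul_left_comm, mul_assoc, mul_inv_cancel_left]
    rw [e]
    exact (totPos F).div_mem ((totPos F).mul_mem hpos1 hs) hs'
  · rw [mul_div_cancel]
    ext1
    refine mul_right_cancel₀ hb ?_
    rw [← hI', Units.val_mul, coe_toPrincipalIdeal, mul_right_comm, ← hI,
      spanSingleton_mul_spanSingleton, ← Units.val_mul, mul_div_cancel]
  · rw [mul_div_cancel]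
    ext1
    refine mul_right_cancel₀ hTbm ?_
    rw [← hJ', Units.val_mul, coe_toPrincipalIdeal, mul_right_comm, ← hJ,
      spanSingleton_mul_spanSingleton, ← Units.val_mul, mul_div_cancel]

theorem IsAttached.of_cusp_eq {𝔱 : NarrowClassGroup F → IdealGroup F} {A A' : GL2Plus F}
    {l l' : NarrowClassGroup F} (h : cusp 𝔱 𝔫 A l = cusp 𝔱 𝔫 A' l')
    (hm : mIdeal (𝔱 l) 𝔫 A = (𝔪 : FractionalIdeal (𝓞 F)⁰ F))
    (hA : IsAttached (𝔱 l) 𝔪 𝔫 (A.1 0 0) (A.1 1 0) I J) :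
    IsAttached (𝔱 l') 𝔪 𝔫 (A'.1 0 0) (A'.1 1 0) I J := by
  obtain rfl := fst_eq_of_cusp_eq h
  obtain ⟨γ, hγ, ρ, hρ, e0, e1⟩ := cusp_eq_iff.1 h
  rw [e0, e1]
  exact (hA.gamma (GL2Plus_column_ne_zero A) hm hγ).smul (Units.mk0 ρ hρ)

end RayClassesOfCusps

/-! ### The bijection between cusps of level ideal `𝔪` and `Q_{𝔪,𝔫}` -/

section Bijection

variable {F : Type*} [Field F] [NumberField F]

/-- Cusps whose attached pairs have the same class in `Q_{𝔪,𝔫}` are equal. -/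
theorem cusp_eq_of_mk_eq_mk {𝔱 : NarrowClassGroup F → IdealGroup F} {𝔪 𝔫 : Ideal (𝓞 F)}
    (hn : 𝔫 ≠ ⊥) (hmn : 𝔪 ∣ 𝔫) (ht : ∀ l : NarrowClassGroup F, QuotientGroup.mk (𝔱 l) = l)
    {A A' : GL2Plus F} {l l' : NarrowClassGroup F}
    (hm : mIdeal (𝔱 l) 𝔫 A = (𝔪 : FractionalIdeal (𝓞 F)⁰ F))
    (hm' : mIdeal (𝔱 l') 𝔫 A' = (𝔪 : FractionalIdeal (𝓞 F)⁰ F))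
    {I I' : coprimeIdeals 𝔪} {J J' : coprimeIdeals (idealDiv 𝔫 𝔪)}
    (h : IsAttached (𝔱 l) 𝔪 𝔫 (A.1 0 0) (A.1 1 0) I J)
    (h' : IsAttached (𝔱 l') 𝔪 𝔫 (A'.1 0 0) (A'.1 1 0) I' J')
    (hQ : (Q.mk I J : Q 𝔪 𝔫) = Q.mk I' J') : cusp 𝔱 𝔫 A l = cusp 𝔱 𝔫 A' l' := by
  have hk := idealDiv_dvd hn hmn
  have h0 := GL2Plus_column_ne_zero A
  have hm0 : (𝔪 : FractionalIdeal (𝓞 F)⁰ F) ≠ 0 :=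
    coeIdeal_ne_zero.2 (ne_zero_of_dvd_ne_zero hn hmn)
  obtain ⟨x, hx, u, hu, w, hw, hII, hJJ⟩ := (Q.mk_eq_mk_iff hn hmn).1 hQ
  obtain ⟨α, χ, hs, hα, hχ, hI, hJ⟩ := h
  obtain ⟨α', χ', hs', hα', hχ', hI', hJ'⟩ := h'
  set a := A.1 0 0
  set c := A.1 1 0
  set a' := A'.1 0 0
  set c' := A'.1 1 0
  -- all the ideals as elements of the group of fractional ideals
  let P := toPrincipalIdeal (𝓞 F) F
  have hD : (differentIdeal ℤ (𝓞 F) : FractionalIdeal (𝓞 F)⁰ F) ≠ 0 := by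
    rw [coeIdeal_ne_zero]
    exact differentIdeal_ne_bot
  obtain ⟨D, eD⟩ : ∃ D : IdealGroup F,
    (D : FractionalIdeal (𝓞 F)⁰ F) = (differentIdeal ℤ (𝓞 F) : FractionalIdeal (𝓞 F)⁰ F) :=
    ⟨Units.mk0 _ hD, rfl⟩
  obtain ⟨M, eM⟩ : ∃ M : IdealGroup F, (M : FractionalIdeal (𝓞 F)⁰ F) = 𝔪 :=
    ⟨Units.mk0 _ hm0, rfl⟩
  obtain ⟨b, eb⟩ : ∃ b : IdealGroup F,
    (b : FractionalIdeal (𝓞 F)⁰ F) = columnIdeal (tdIdeal (𝔱 l)) a c :=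
    ⟨Units.mk0 _ (columnIdeal_ne_zero (tdIdeal_ne_zero _) h0), rfl⟩
  obtain ⟨b', eb'⟩ : ∃ b' : IdealGroup F,
    (b' : FractionalIdeal (𝓞 F)⁰ F) = columnIdeal (tdIdeal (𝔱 l')) a' c' :=
    ⟨Units.mk0 _ (columnIdeal_ne_zero (tdIdeal_ne_zero _) (GL2Plus_column_ne_zero A')), rfl⟩
  have eT : ∀ l, tdIdeal (𝔱 l) = ((𝔱 l * D : IdealGroup F) : FractionalIdeal (𝓞 F)⁰ F) := by
    intro l
    rw [Units.val_mul, eD, tdIdeal]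
  have gI : P α = I * b := by
    ext1
    rw [coe_toPrincipalIdeal, hI, Units.val_mul, eb]
  have gJ : P χ = J * (𝔱 l * D * b * M) := by
    ext1
    rw [coe_toPrincipalIdeal, hJ, ← eb, ← eM, eT]
    push_cast
    rfl
  have gI' : P α' = I * (P x * P u) * b' := by
    rw [← map_mul, ← hII]
    ext1
    rw [coe_toPrincipalIdeal, hI', Units.val_mul, eb']
  have gJ' : P χ' = J * (P x * P w) * (𝔱 l' * D * b' * M) := by
    rw [← map_mul, ← hJJ]
    ext1
    rw [coe_toPrincipalIdeal, hJ', ← eb', ← eM, eT]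
    push_cast
    rfl
  -- the ratio of the two ideals `𝔱` is principal with a totally positive generator
  let η : Fˣ := α / χ / (α' / χ') * (u / w)
  have hη : η ∈ totPos F :=
    (totPos F).mul_mem ((totPos F).div_mem hs hs') ((totPos F).div_mem hu.1 hw.1)
  have hPη : P η = 𝔱 l' / 𝔱 l := by
    simp only [η, map_mul, map_div, gI, gJ, gI', gJ']
    ext1
    push_cast [Units.val_div_eq_div_val]
    field_simp
  obtain rfl : l = l' := by
    rw [← ht l, ← ht l', QuotientGroup.eq, Subgroup.mem_map]
    exact ⟨η, hη, by rw [inv_mul_eq_div]; exact hPη⟩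
  rw [div_self'] at hPη
  -- the scalar that matches the two columns
  let ρ : Fˣ := χ' / (χ * (x * w))
  have hρ : P ρ * b = b' := by
    simp only [ρ, map_mul, map_div, gJ, gJ']
    ext1
    push_cast [Units.val_div_eq_div_val]
    field_simp
  have eχ' : χ' = x * w * (ρ * χ) := by
    simp only [ρ]
    ext1
    push_cast [Units.val_div_eq_div_val]
    field_simp
  have eα' : η * α' = x * u * (ρ * α) := by
    simp only [ρ, η]
    ext1
    push_cast [Units.val_div_eq_div_val]
    field_simp
  have hcol : columnIdeal (tdIdeal (𝔱 l)) (ρ * a) (ρ * c) = columnIdeal (tdIdeal (𝔱 l)) a' c' := by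
    rw [columnIdeal_smul, ← eb', ← hρ, Units.val_mul, eb, coe_toPrincipalIdeal]
  have hlev : levelIdeal (tdIdeal (𝔱 l)) (𝔫 : FractionalIdeal (𝓞 F)⁰ F) (ρ * a) (ρ * c) = 𝔪 := by
    rw [levelIdeal_smul _ _ ρ.ne_zero]
    exact hm
  have h0ρ : (ρ : F) * a ≠ 0 ∨ (ρ : F) * c ≠ 0 :=
    h0.imp (mul_ne_zero ρ.ne_zero) (mul_ne_zero ρ.ne_zero)
  obtain ⟨v, hv⟩ := exists_unit_of_principal_eq_one hPη
  obtain ⟨v', hv'⟩ := exists_unit_of_principal_eq_one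
    (x := η⁻¹) (by rw [map_inv, hPη, inv_one])
  -- the ideals `𝔟`, `𝔟𝔪`, `T𝔟𝔪`, `T𝔟𝔫` of the scaled column are those of the second column
  have hρα : (ρ : F) * (α - a) ∈ columnIdeal (tdIdeal (𝔱 l)) a' c' * (𝔪 : FractionalIdeal _ F) := by
    rw [← hcol, columnIdeal_smul, mul_assoc]
    exact mul_mem_mul (mem_spanSingleton_self _ _) hα
  have hρχ : (ρ : F) * (χ - c) ∈
      tdIdeal (𝔱 l) * columnIdeal (tdIdeal (𝔱 l)) a' c' * (𝔫 : FractionalIdeal _ F) := by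
    rw [← hcol, columnIdeal_smul]
    exact mul_mem_of_eq (mem_spanSingleton_self _ _) hχ (by ring)
  have hρα' : (ρ : F) * α - ρ * a ∈
      columnIdeal (tdIdeal (𝔱 l)) (ρ * a) (ρ * c) * (𝔪 : FractionalIdeal _ F) := by
    rwa [hcol, ← mul_sub]
  have hρχ' : (ρ : F) * χ - ρ * c ∈
      tdIdeal (𝔱 l) * columnIdeal (tdIdeal (𝔱 l)) (ρ * a) (ρ * c) * (𝔫 : FractionalIdeal _ F) := by
    rwa [hcol, ← mul_sub]
  have mem_of_add : ∀ {y : F} {L L' : FractionalIdeal (𝓞 F)⁰ F},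
      spanSingleton (𝓞 F)⁰ y + L = L' → y ∈ L' := fun h =>
    spanSingleton_le_iff_mem.1 (h ▸ le_sup_left)
  have k1 : (ρ : F) * α ∈ columnIdeal (tdIdeal (𝔱 l)) a' c' :=
    hcol ▸ mem_of_add (upper_span_add h0ρ hlev hρα')
  have k2 : (ρ : F) * χ ∈ tdIdeal (𝔱 l) * columnIdeal (tdIdeal (𝔱 l)) a' c' * 𝔪 :=
    hcol ▸ mem_of_add (lower_span_add hn hmn h0ρ hlev hρχ')
  have k3 : (α' : F) ∈ columnIdeal (tdIdeal (𝔱 l)) a' c' :=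
    mem_of_add (upper_span_add (GL2Plus_column_ne_zero A') hm' hα')
  have k4 : (χ' : F) ∈ tdIdeal (𝔱 l) * columnIdeal (tdIdeal (𝔱 l)) a' c' * 𝔪 :=
    mem_of_add (lower_span_add hn hmn (GL2Plus_column_ne_zero A') hm' hχ')
  have eα : (η : F) * α' = ((x * u : Fˣ) : F) * (ρ * α) := by
    simpa only [Units.val_mul] using congrArg Units.val eα'
  have eχ : (χ' : F) = ((x * w : Fˣ) : F) * (ρ * χ) := by
    simpa only [Units.val_mul] using congrArg Units.val eχ'
  have d1 : (η : F) * α' - ρ * α ∈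
      columnIdeal (tdIdeal (𝔱 l)) a' c' * (𝔪 : FractionalIdeal _ F) := by
    rw [eα]
    refine mul_sub_mem_of_mem_congrOne
      ((congrOne 𝔪).mul_mem (congrOne_mono hmn hx) hu.2) k1 ?_
    rw [← eα, hv]
    exact int_mul_mem (coe_mem_one _ _) k3
  have d2 : (χ' : F) - ρ * χ ∈
      tdIdeal (𝔱 l) * columnIdeal (tdIdeal (𝔱 l)) a' c' * (𝔫 : FractionalIdeal _ F) := by
    rw [← coe_mul_idealDiv hn hmn, ← mul_assoc, eχ]
    exact mul_sub_mem_of_mem_congrOne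
      ((congrOne _).mul_mem (congrOne_mono hk hx) hw.2) k2 (eχ ▸ k4)
  obtain ⟨γ, hγ, e0, e1⟩ := exists_Gamma1_of_congr (𝔱 := 𝔱 l) (𝔫 := 𝔫) (a := ρ * a) (c := ρ * c)
    (a' := a') (c' := c') h0ρ (e := η⁻¹) ((totPos F).inv_mem hη) (by rw [map_inv, hPη, inv_one])
    hcol.symm (by
      rw [hcol]
      have e : c' - ρ * c = (χ' - ρ * χ) + ρ * (χ - c) - (χ' - c') := by ring
      rw [e]
      exact Submodule.sub_mem _ (Submodule.add_mem _ d2 hρχ) hχ') (by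
      rw [hcol, hlev]
      have e : a' - ((η⁻¹ : Fˣ) : F) * (ρ * a) =
          ((η⁻¹ : Fˣ) : F) * ((η * α' - ρ * α) + ρ * (α - a)) - (α' - a') := by
        linear_combination (-(α' : F)) * η.inv_mul
      rw [e, hv']
      exact Submodule.sub_mem _ (int_mul_mem (coe_mem_one _ _) (Submodule.add_mem _ d1 hρα)) hα')
  exact cusp_eq_iff.2 ⟨γ, hγ, ρ, ρ.ne_zero, by linear_combination -e0, by linear_combination -e1⟩

/-- Every class of `Q_{𝔪,𝔫}` comes from a cusp. Choose representatives `I`, `J` with `J` integral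
prime to `𝔫/𝔪` and `I` integral prime to `𝔪J`; the column `(1, s)` with `(s) = T𝔪JI⁻¹` does it. -/
theorem exists_isAttached_of_class {𝔱 : NarrowClassGroup F → IdealGroup F} {𝔪 𝔫 : Ideal (𝓞 F)}
    (hn : 𝔫 ≠ ⊥) (hmn : 𝔪 ∣ 𝔫) (ht : ∀ l : NarrowClassGroup F, QuotientGroup.mk (𝔱 l) = l)
    (q : Q 𝔪 𝔫) :
    ∃ (A : GL2Plus F) (l : NarrowClassGroup F) (I : coprimeIdeals 𝔪)
      (J : coprimeIdeals (idealDiv 𝔫 𝔪)), mIdeal (𝔱 l) 𝔫 A = (𝔪 : FractionalIdeal (𝓞 F)⁰ F) ∧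
        IsAttached (𝔱 l) 𝔪 𝔫 (A.1 0 0) (A.1 1 0) I J ∧ Q.mk I J = q := by
  obtain ⟨I₀, J₀, rfl⟩ := Q.exists_mk_eq q
  have hk0 : idealDiv 𝔫 𝔪 ≠ ⊥ := ne_zero_of_dvd_ne_zero hn (idealDiv_dvd hn hmn)
  have hm0 : 𝔪 ≠ ⊥ := ne_zero_of_dvd_ne_zero hn hmn
  obtain ⟨w, hw, hJ⟩ := exists_mul_add_eq_one hk0 dvd_rfl J₀.2
  obtain ⟨N, hN⟩ := le_one_iff_exists_coeIdeal.1 (hJ ▸ le_sup_left :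
    spanSingleton (𝓞 F)⁰ (w : F) * ((J₀ : IdealGroup F) : FractionalIdeal (𝓞 F)⁰ F) ≤ 1)
  have hN0 : N ≠ ⊥ := by
    rintro rfl
    rw [coeIdeal_bot] at hN
    exact mul_ne_zero (spanSingleton_ne_zero_iff.2 w.ne_zero) (Units.ne_zero _) hN.symm
  obtain ⟨u, hu, hI⟩ := exists_mul_add_eq_one (J := 𝔪 * N) (mul_ne_zero hm0 hN0)
    (dvd_mul_right _ _) I₀.2
  let P := toPrincipalIdeal (𝓞 F) F
  let I : coprimeIdeals 𝔪 := ⟨P u * I₀, (coprimeIdeals 𝔪).mul_mem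
    (principal_mem_coprimeIdeals hu.2) I₀.2⟩
  let J : coprimeIdeals (idealDiv 𝔫 𝔪) := ⟨P w * J₀, (coprimeIdeals _).mul_mem
    (principal_mem_coprimeIdeals hw.2) J₀.2⟩
  have hIJ : (Q.mk I J : Q 𝔪 𝔫) = Q.mk I₀ J₀ := by
    refine Eq.symm ((Q.mk_eq_mk_iff hn hmn).2 ⟨1, one_mem _, u, hu, w, hw, ?_, ?_⟩)
    · rw [one_mul, mul_comm]
    · rw [one_mul, mul_comm]
  have eI : (((I : IdealGroup F) : FractionalIdeal (𝓞 F)⁰ F)) =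
      spanSingleton (𝓞 F)⁰ (u : F) * ((I₀ : IdealGroup F) : FractionalIdeal (𝓞 F)⁰ F) := by
    rw [← coe_toPrincipalIdeal, ← Units.val_mul]
  have eJ : (((J : IdealGroup F) : FractionalIdeal (𝓞 F)⁰ F)) =
      spanSingleton (𝓞 F)⁰ (w : F) * ((J₀ : IdealGroup F) : FractionalIdeal (𝓞 F)⁰ F) := by
    rw [← coe_toPrincipalIdeal, ← Units.val_mul]
  rw [← eI, coeIdeal_mul, hN, ← eJ] at hI
  rw [← eJ] at hJ
  have hI0 : ((I : IdealGroup F) : FractionalIdeal (𝓞 F)⁰ F) ≠ 0 := Units.ne_zero _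
  have hmF : (𝔪 : FractionalIdeal (𝓞 F)⁰ F) ≠ 0 := coeIdeal_ne_zero.2 hm0
  have hD : (differentIdeal ℤ (𝓞 F) : FractionalIdeal (𝓞 F)⁰ F) ≠ 0 := by
    rw [coeIdeal_ne_zero]
    exact differentIdeal_ne_bot
  let L : IdealGroup F := I / (J * Units.mk0 _ hD * Units.mk0 _ hmF)
  let l : NarrowClassGroup F := QuotientGroup.mk L
  have hl : (QuotientGroup.mk L : NarrowClassGroup F) = QuotientGroup.mk (𝔱 l) := (ht l).symm
  rw [QuotientGroup.eq, Subgroup.mem_map] at hl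
  obtain ⟨s, hs, es⟩ := hl
  have hT := tdIdeal_ne_zero (𝔱 l)
  have hsF : spanSingleton (𝓞 F)⁰ (s : F) =
      tdIdeal (𝔱 l) * (𝔪 : FractionalIdeal _ F) * ((J : IdealGroup F) : FractionalIdeal _ F) * ((I : IdealGroup F) : FractionalIdeal _ F)⁻¹ := by
    rw [← coe_toPrincipalIdeal, es]
    simp only [L, inv_div, Units.val_mul, Units.val_div_eq_div_val, Units.val_mk0, tdIdeal]
    field_simp
  have hcol : columnIdeal (tdIdeal (𝔱 l)) (1 : F) (s : F) =
      ((I : IdealGroup F) : FractionalIdeal (𝓞 F)⁰ F)⁻¹ := by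
    have e : spanSingleton (𝓞 F)⁰ (s : F) * (tdIdeal (𝔱 l))⁻¹ =
        ((I : IdealGroup F) : FractionalIdeal (𝓞 F)⁰ F)⁻¹ * ((𝔪 : FractionalIdeal _ F) * ((J : IdealGroup F) : FractionalIdeal _ F)) := by
      rw [hsF]
      field_simp
    rw [columnIdeal, e, add_mul_eq_self_iff (inv_ne_zero hI0), spanSingleton_one, inv_inv, one_mul]
    exact hI
  obtain ⟨A, h00, -, h10, -⟩ := exists_GL2Plus (1 : F) 0 s 1 1 (one_mem _) (by simp)
  refine ⟨A, l, I, J, ?_, ?_, hIJ⟩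
  · change levelIdeal _ _ _ _ = _
    rw [h00, h10, levelIdeal, hcol, ← coe_mul_idealDiv hn hmn]
    have e : spanSingleton (𝓞 F)⁰ (s : F) *
        (tdIdeal (𝔱 l) * ((I : IdealGroup F) : FractionalIdeal (𝓞 F)⁰ F)⁻¹)⁻¹ =
        (𝔪 : FractionalIdeal _ F) * ((J : IdealGroup F) : FractionalIdeal _ F) := by
      rw [hsF]
      field_simp
    rw [e, ← mul_add, hJ, mul_one]
  · rw [h00, h10]
    refine ⟨1, s, ?_, ?_, ?_, ?_, ?_⟩
    · rw [_root_.one_div]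
      exact (totPos F).inv_mem hs
    · rw [Units.val_one, sub_self]
      exact Submodule.zero_mem _
    · rw [sub_self]
      exact Submodule.zero_mem _
    · rw [hcol, mul_inv_cancel₀ hI0, Units.val_one, spanSingleton_one]
    · rw [hcol, hsF]
      ring

/-- The cusps of level ideal `𝔪` are in bijection with `Q_{𝔪,𝔫}`: both are quotients of the set of
pairs `(A, λ)` with `𝔪_𝒜 = 𝔪`, by the same equivalence relation. -/
theorem nonempty_stratum_equiv_Q {𝔱 : NarrowClassGroup F → IdealGroup F} {𝔪 𝔫 : Ideal (𝓞 F)}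
    (hn : 𝔫 ≠ ⊥) (hmn : 𝔪 ∣ 𝔫) (ht : ∀ l : NarrowClassGroup F, QuotientGroup.mk (𝔱 l) = l) :
    Nonempty (stratum 𝔱 𝔪 𝔫 ≃ Q 𝔪 𝔫) := by
  have hex : ∀ x : stratum 𝔱 𝔪 𝔫, ∃ (q : Q 𝔪 𝔫) (A : GL2Plus F) (l : NarrowClassGroup F)
      (I : coprimeIdeals 𝔪) (J : coprimeIdeals (idealDiv 𝔫 𝔪)), (x : Cusps 𝔱 𝔫) = cusp 𝔱 𝔫 A l ∧
        mIdeal (𝔱 l) 𝔫 A = (𝔪 : FractionalIdeal (𝓞 F)⁰ F) ∧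
        IsAttached (𝔱 l) 𝔪 𝔫 (A.1 0 0) (A.1 1 0) I J ∧ Q.mk I J = q := by
    rintro ⟨_, A, l, rfl, hm⟩
    have h0 := GL2Plus_column_ne_zero A
    obtain ⟨I, J, h⟩ := exists_isAttached (𝔱 := 𝔱 l) hn hmn h0
    obtain ⟨hI, hJ⟩ := h.mem_coprimeIdeals hn hmn h0 hm
    exact ⟨Q.mk ⟨I, hI⟩ ⟨J, hJ⟩, A, l, ⟨I, hI⟩, ⟨J, hJ⟩, rfl, hm, h, rfl⟩
  choose f A l I J hx hm hA hf using hex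
  refine ⟨Equiv.ofBijective f ⟨fun x y hxy => ?_, fun q => ?_⟩⟩
  · ext1
    rw [hx x, hx y]
    exact cusp_eq_of_mk_eq_mk hn hmn ht (hm x) (hm y) (hA x) (hA y) (by rw [hf, hf, hxy])
  · obtain ⟨A', l', I', J', hm', hA', rfl⟩ := exists_isAttached_of_class (𝔱 := 𝔱) hn hmn ht q
    let x : stratum 𝔱 𝔪 𝔫 := ⟨cusp 𝔱 𝔫 A' l', A', l', rfl, hm'⟩
    refine ⟨x, ?_⟩
    rw [← hf x]
    have h := hA'.of_cusp_eq (hx x) hm'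
    exact (hA x).mk_eq_mk hn hmn (GL2Plus_column_ne_zero _) (hm x) h

theorem exists_mem_stratum {𝔱 : NarrowClassGroup F → IdealGroup F} {𝔫 : Ideal (𝓞 F)}
    (x : Cusps 𝔱 𝔫) : ∃ 𝔪, 𝔪 ∣ 𝔫 ∧ x ∈ stratum 𝔱 𝔪 𝔫 := by
  obtain ⟨l, x⟩ := x
  obtain ⟨A, rfl⟩ := Quotient.exists_rep x
  have hle : mIdeal (𝔱 l) 𝔫 A ≤ 1 :=
    levelIdeal_le_one (tdIdeal_ne_zero _) coeIdeal_le_one (GL2Plus_column_ne_zero A)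
  obtain ⟨𝔪, hm⟩ := le_one_iff_exists_coeIdeal.1 hle
  refine ⟨𝔪, ?_, A, l, rfl, hm.symm⟩
  rw [Ideal.dvd_iff_le, ← coeIdeal_le_coeIdeal F, hm]
  exact le_sup_right

theorem eq_of_mem_stratum {𝔱 : NarrowClassGroup F → IdealGroup F} {𝔪 𝔪' 𝔫 : Ideal (𝓞 F)}
    {x : Cusps 𝔱 𝔫} (h : x ∈ stratum 𝔱 𝔪 𝔫) (h' : x ∈ stratum 𝔱 𝔪' 𝔫) : 𝔪 = 𝔪' := by
  obtain ⟨A, l, rfl, hm⟩ := h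
  obtain ⟨A', l', e, hm'⟩ := h'
  rw [← coeIdeal_inj (K := F), ← hm, ← hm', mIdeal_eq_of_cusp_eq e]

end Bijection

end HilbertCusps

theorem corollary3p9 (F : Type*) [Field F] [NumberField F] [NumberField.IsTotallyReal F]
    (𝔫 : Ideal (𝓞 F)) (hn : 𝔫 ≠ ⊥)
    (𝔱 : HilbertCusps.NarrowClassGroup F → HilbertCusps.IdealGroup F)
    (ht : ∀ l : HilbertCusps.NarrowClassGroup F, QuotientGroup.mk (𝔱 l) = l)
    (htn : ∀ l : HilbertCusps.NarrowClassGroup F, 𝔱 l ∈ HilbertCusps.coprimeIdeals 𝔫) :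
    (⋃ 𝔪 ∈ {𝔪 : Ideal (𝓞 F) | 𝔪 ∣ 𝔫}, HilbertCusps.stratum 𝔱 𝔪 𝔫) = Set.univ ∧
    {𝔪 : Ideal (𝓞 F) | 𝔪 ∣ 𝔫}.PairwiseDisjoint (fun 𝔪 => HilbertCusps.stratum 𝔱 𝔪 𝔫) ∧
    (∀ 𝔪 : Ideal (𝓞 F), 𝔪 ∣ 𝔫 →
      Finite (HilbertCusps.stratum 𝔱 𝔪 𝔫) ∧ Finite (HilbertCusps.Q 𝔪 𝔫) ∧
      Nat.card (HilbertCusps.stratum 𝔱 𝔪 𝔫) = Nat.card (HilbertCusps.Q 𝔪 𝔫)) ∧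
    Finite (HilbertCusps.Cusps 𝔱 𝔫) ∧
    Nat.card (HilbertCusps.Cusps 𝔱 𝔫) =
      ∑ 𝔪 ∈ (HilbertCusps.finite_divisors hn).toFinset, Nat.card (HilbertCusps.Q 𝔪 𝔫) := by
  have hunion : (⋃ 𝔪 ∈ {𝔪 : Ideal (𝓞 F) | 𝔪 ∣ 𝔫}, HilbertCusps.stratum 𝔱 𝔪 𝔫) = Set.univ := by
    refine Set.eq_univ_of_forall fun x => ?_
    obtain ⟨𝔪, hm, hx⟩ := HilbertCusps.exists_mem_stratum x
    exact Set.mem_biUnion hm hx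
  have hdisj : {𝔪 : Ideal (𝓞 F) | 𝔪 ∣ 𝔫}.PairwiseDisjoint
      (fun 𝔪 => HilbertCusps.stratum 𝔱 𝔪 𝔫) := fun 𝔪 _ 𝔪' _ hne =>
    Set.disjoint_left.2 fun _ h h' => hne (HilbertCusps.eq_of_mem_stratum h h')
  have hcard : ∀ 𝔪 : Ideal (𝓞 F), 𝔪 ∣ 𝔫 →
      Finite (HilbertCusps.stratum 𝔱 𝔪 𝔫) ∧ Finite (HilbertCusps.Q 𝔪 𝔫) ∧
      Nat.card (HilbertCusps.stratum 𝔱 𝔪 𝔫) = Nat.card (HilbertCusps.Q 𝔪 𝔫) := by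
    intro 𝔪 hm
    obtain ⟨e⟩ := HilbertCusps.nonempty_stratum_equiv_Q hn hm ht
    have := HilbertCusps.finite_Q hn hm
    exact ⟨Finite.of_equiv _ e.symm, this, Nat.card_congr e⟩
  have hfin := HilbertCusps.finite_divisors hn
  have huniv : (Set.univ : Set (HilbertCusps.Cusps 𝔱 𝔫)).Finite := by
    rw [← hunion]
    exact hfin.biUnion fun 𝔪 hm => (hcard 𝔪 hm).1
  refine ⟨hunion, hdisj, hcard, Set.finite_univ_iff.1 huniv, ?_⟩
  rw [← Set.ncard_univ, ← hunion, hfin.ncard_biUnion (fun 𝔪 hm => (hcard 𝔪 hm).1) hdisj,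
    finsum_mem_eq_finite_toFinset_sum _ hfin]
  exact Finset.sum_congr rfl fun 𝔪 hm => (hcard 𝔪 (hfin.mem_toFinset.1 hm)).2.2
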